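/- Conventions. Banach spaces are real and of dimension at least $1$; for a compact Hausdorff space $K$ and a Banach space $E$, $\mathcal C(K,E)$ is the space of continuous functions $K\to E$ with the supremum norm, and $\mathcal C(K)=\mathcal C(K,\mathbb R)$. For a closed linear subspace $\mathcal H\subseteq\mathcal C(K,E)$ let $\mathcal A\subseteq\mathcal C(K)$ be the closed linear span of the functions $x\mapsto\langle e^*,h(x)\rangle$ with $e^*\in E^*$, $h\in\mathcal H$. The Choquet boundary $\operatorname{Ch}_{\mathcal H}K$ is the set of all $x\in K$ for which the functional $f\mapsto f(x)$ on $\mathcal A$ is an extreme point of the closed unit ball of $\mathcal A^*$. A point $x\in K$ is a weak peak point (with respect to $\mathcal H$) if for every neighbourhood $U$ of $x$ and every $\varepsilon\in(0,1)$ there is $h\in\mathcal A$ such that the function $y\mapsto h(y)e$ belongs to $\mathcal H$ for every $e\in E$, and $0\le h\le 1$ on $K$, $h(x)>1-\varepsilon$, and $h<\varepsilon$ on $\operatorname{Ch}_{\mathcal H}K\setminus U$. A Banach space contains an isomorphic copy of $Y$ if it has a linear subspace linearly homeomorphic to $Y$; $c_0$ is the space of real null sequences with the supremum norm. Theorem.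 For $i=1,2$, let $K_i$ be a compact Hausdorff space, let $E_i$ be a Banach space not containing an isomorphic copy of $c_0$, and let $\mathcal H_i$ be a closed linear subspace of $\mathcal C(K_i,E_i)$ such that $\operatorname{Ch}_{\mathcal H_i}K_i$ is closed in $K_i$ and countable (possibly finite), and consists of weak peak points with respect to $\mathcal H_i$. Suppose that for all natural numbers $1\le m<n$, $E_1^m$ does not contain an isomorphic copy of $E_2^n$, and $E_2^m$ does not contain an isomorphic copy of $E_1^n$. If there exists a surjective linear isomorphism (linear homeomorphism) $T\colon\mathcal H_1\to\mathcal H_2$ with $\|T\|\,\|T^{-1}\|<3$, then $\operatorname{Ch}_{\mathcal H_1}K_1$ is homeomorphic to $\operatorname{Ch}_{\mathcal H_2}K_2$ (in the subspace topologies). -/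

import Mathlib

open Topology
open scoped ZeroAtInfty

noncomputable section

/-- The Banach space `X` contains an isomorphic copy of `Y`: some linear subspace of `X`
is linearly homeomorphic to `Y`. -/
def ContainsIsomorphicCopy (X Y : Type*) [NormedAddCommGroup X] [NormedSpace ℝ X]
    [NormedAddCommGroup Y] [NormedSpace ℝ Y] : Prop :=
  ∃ Z : Submodule ℝ X, Nonempty (Y ≃L[ℝ] Z)

/-- `E` contains an isomorphic copy of `c₀`, the space of real null sequences with the
supremum norm. -/
def ContainsCZero (E : Type*) [NormedAddCommGroup E] [NormedSpace ℝ E] : Prop :=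
  ContainsIsomorphicCopy E C₀(ℕ, ℝ)

section FunctionSpaces

variable {K E : Type*} [TopologicalSpace K] [CompactSpace K]
  [NormedAddCommGroup E] [NormedSpace ℝ E]

/-- The scalar function `x ↦ ⟨φ, h x⟩` for `φ ∈ E*` and `h ∈ C(K, E)`. -/
def dualComp (φ : StrongDual ℝ E) (h : C(K, E)) : C(K, ℝ) :=
  ⟨fun x => φ (h x), φ.continuous.comp h.continuous⟩

/-- The function `f ⊗ e`, that is `x ↦ f x • e`. -/
def tensorVec (f : C(K, ℝ)) (e : E) : C(K, E) :=
  ⟨fun x => f x • e, f.continuous.smul continuous_const⟩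

/-- The canonical scalar function space `A` of `H`: the closed linear span in `C(K, ℝ)` of all
functions `φ ∘ h` with `φ ∈ E*` and `h ∈ H`. -/
def scalarSpace (H : Submodule ℝ C(K, E)) : Submodule ℝ C(K, ℝ) :=
  (Submodule.span ℝ
    {f : C(K, ℝ) | ∃ φ : StrongDual ℝ E, ∃ h ∈ H, f = dualComp φ h}).topologicalClosure

/-- The evaluation functional `f ↦ f x` on a subspace `A` of `C(K, ℝ)`. -/
def evalFunctional (A : Submodule ℝ C(K, ℝ)) (x : K) : StrongDual ℝ A :=
  (ContinuousMap.evalCLM ℝ x : C(K, ℝ) →L[ℝ] ℝ).comp A.subtypeL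

/-- The closed unit ball of the dual `A*` of a subspace `A` of `C(K, ℝ)` in the dual norm: the
continuous linear functionals `φ` on `A` with `|φ f| ≤ ‖f‖` for all `f ∈ A`. -/
def dualUnitBall (A : Submodule ℝ C(K, ℝ)) : Set (StrongDual ℝ A) :=
  {φ | ∀ f : A, |φ f| ≤ ‖(f : C(K, ℝ))‖}

/-- The Choquet boundary of `H`: the points `x` whose evaluation functional on the scalar
function space `A` of `H` is an extreme point of the closed unit ball of `A*`. -/
def choquetBoundary (H : Submodule ℝ C(K, E)) : Set K :=
  {x | evalFunctional (scalarSpace H) x ∈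
    Set.extremePoints ℝ (dualUnitBall (scalarSpace H))}

/-- The point `x` is a weak peak point with respect to `H`. The functions `h` range over those
elements of the scalar function space with `h ⊗ e ∈ H` for every `e ∈ E`. -/
def IsWeakPeakPoint (H : Submodule ℝ C(K, E)) (x : K) : Prop :=
  ∀ U ∈ 𝓝 x, ∀ ε : ℝ, 0 < ε → ε < 1 →
    ∃ h ∈ scalarSpace H, (∀ e : E, tensorVec h e ∈ H) ∧
      (∀ y, 0 ≤ h y ∧ h y ≤ 1) ∧ 1 - ε < h x ∧ ∀ y ∈ choquetBoundary H \ U, h y < ε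

end FunctionSpaces

end

/-!
Functions in the scalar space attain their norm on the Choquet boundary, because every extreme
point of its dual unit ball is a signed evaluation (Milman's theorem). Hence `H` restricts
isometrically to the functions on its Choquet boundary. Peak functions make this restriction
surjective: the closed set of points near which not every function is reached would otherwise have
an isolated point, the boundary being countable, and a peak function at that point reaches the
missing functions.

It remains to compare countable compact spaces `K` and `L` along an isomorphism `T` from `C(K, E)`
to `C(L, F)` with distortion below `3`. Countable compact spaces whose Cantor–Bendixson derived
sets of equal order have equally many points are homeomorphic. If `T f` is small on the `α`-th
derived set of `L`, then for every point `x` of the `α`-th derived set of `K` some clopen set `W`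
near `x` makes `T (f + 2 • W.indicator f)` essentially no larger than `‖T‖ * ‖f‖`. Here `F` not
containing `c₀` is used: restrictions of `f` to disjoint clopen sets have images that tend to zero
pointwise. As `f + 2 • W.indicator f` is `3 • f` on `W`, the distortion bound keeps `‖f x‖` below
a fixed fraction of `‖f‖`. So evaluating `T f` on the `α`-th derived set of `L` embeds a power of
`E`, with one factor for each of finitely many points of the `α`-th derived set of `K`, into the
corresponding power of `F`, which bounds the number of these points.
-/

noncomputable section

open Set Filter TopologicalSpace
open scoped NNReal

section IteratedDerivedSet

/-- The Cantor–Bendixson derived sets of a space: `x` lies in the `α`-th one if it is an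
accumulation point of the `β`-th one for all `β < α`, so that the `0`-th one is the whole space.
In contrast to `CantorBendixson.iteratedDerivedSet`, the ordinals are taken in a universe that does
not depend on `X`, so that spaces in different universes can be compared. -/
def iteratedDerivedSet (X : Type*) [TopologicalSpace X] (α : Ordinal.{0}) : Set X :=
  {x | ∀ β, β < α → AccPt x (𝓟 (iteratedDerivedSet X β))}
termination_by α

variable {X : Type*} [TopologicalSpace X] {α β : Ordinal.{0}}

theorem mem_iteratedDerivedSet {x : X} :
    x ∈ iteratedDerivedSet X α ↔ ∀ β < α, AccPt x (𝓟 (iteratedDerivedSet X β)) := by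
  rw [iteratedDerivedSet, mem_ofPred_eq]

theorem iteratedDerivedSet_antitone : Antitone (iteratedDerivedSet X) := fun _ _ h _ hx =>
  mem_iteratedDerivedSet.2 fun γ hγ => mem_iteratedDerivedSet.1 hx γ (hγ.trans_le h)

theorem iteratedDerivedSet_zero : iteratedDerivedSet X 0 = univ :=
  eq_univ_of_forall fun _ => mem_iteratedDerivedSet.2 fun _ hβ => absurd hβ not_lt_zero

theorem iteratedDerivedSet_eq_iInter (α : Ordinal.{0}) :
    iteratedDerivedSet X α = ⋂ β : Iio α, derivedSet (iteratedDerivedSet X β) := by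
  ext x
  simp [mem_iteratedDerivedSet, derivedSet]

theorem isClosed_iteratedDerivedSet [T1Space X] (α : Ordinal.{0}) :
    IsClosed (iteratedDerivedSet X α) := by
  rw [iteratedDerivedSet_eq_iInter]
  exact isClosed_iInter fun β => isClosed_derivedSet _

theorem exists_ne_mem_iteratedDerivedSet (h : β < α) {x : X} (hx : x ∈ iteratedDerivedSet X α)
    {U : Set X} (hU : IsOpen U) (hxU : x ∈ U) : ∃ y ∈ U ∩ iteratedDerivedSet X β, y ≠ x :=
  accPt_iff_nhds.1 (mem_iteratedDerivedSet.1 hx β h) U (hU.mem_nhds hxU)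

theorem exists_finite_inter_iteratedDerivedSet [CompactSpace X] [T1Space X] {G : Set X}
    (hG : IsClosed G) (hne : G.Nonempty) {γ : Ordinal.{0}}
    (hγ : G ∩ iteratedDerivedSet X γ = ∅) :
    ∃ β < γ, (G ∩ iteratedDerivedSet X β).Nonempty ∧ (G ∩ iteratedDerivedSet X β).Finite := by
  induction γ using WellFoundedLT.induction with
  | ind γ ih =>
    by_cases hlt : ∃ β < γ, G ∩ iteratedDerivedSet X β = ∅
    · obtain ⟨β, hβ, hβe⟩ := hlt
      obtain ⟨δ, hδ, h⟩ := ih β hβ hβe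
      exact ⟨δ, hδ.trans hβ, h⟩
    push Not at hlt
    suffices ∃ β < γ, (G ∩ iteratedDerivedSet X β).Finite by
      obtain ⟨β, hβ, hfin⟩ := this
      exact ⟨β, hβ, hlt β hβ, hfin⟩
    by_contra! hinf
    have hacc : ∀ β : Iio γ, (G ∩ derivedSet (iteratedDerivedSet X β)).Nonempty := fun β => by
      obtain ⟨x, hxG, hx⟩ := (hinf β β.2).exists_accPt_of_subset_isCompact hG.isCompact
        inter_subset_left
      exact ⟨x, hxG, derivedSet_mono _ _ inter_subset_right hx⟩
    have : Nonempty (Iio γ) := by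
      refine ⟨0, mem_Iio.2 (pos_iff_ne_zero.2 ?_)⟩
      rintro rfl
      exact hne.ne_empty (by simpa [iteratedDerivedSet_zero] using hγ)
    have hdir : Directed (· ⊇ ·)
        fun β : Iio γ => G ∩ derivedSet (iteratedDerivedSet X (β : Ordinal.{0})) :=
      Antitone.directed_ge fun _ _ h =>
        inter_subset_inter_right _ (derivedSet_mono _ _ (iteratedDerivedSet_antitone h))
    have hclosed := fun β : Iio γ => hG.inter (isClosed_derivedSet (iteratedDerivedSet X β))
    have := IsCompact.nonempty_iInter_of_directed_nonempty_isCompact_isClosed _ hdir hacc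
      (fun β => (hclosed β).isCompact) hclosed
    rw [← inter_iInter, ← iteratedDerivedSet_eq_iInter, hγ] at this
    exact not_nonempty_empty this

section TotallyDisconnected

variable [CompactSpace X] [T2Space X] [TotallyDisconnectedSpace X]

theorem exists_clopens_mem_le {x : X} {U : Set X} (hU : IsOpen U) (hx : x ∈ U) :
    ∃ V : Clopens X, x ∈ V ∧ (V : Set X) ⊆ U := by
  obtain ⟨V, hV, h⟩ := compact_exists_isClopen_in_isOpen hU hx
  exact ⟨⟨V, hV⟩, h⟩

theorem exists_seq_disjoint_clopens_inter_iteratedDerivedSet (h : β < α) {x : X}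
    (hx : x ∈ iteratedDerivedSet X α) {U : Clopens X} (hxU : x ∈ U) :
    ∃ V : ℕ → Clopens X, Pairwise (Function.onFun Disjoint V) ∧
      ∀ n, V n ≤ U ∧ ((V n : Set X) ∩ iteratedDerivedSet X β).Nonempty := by
  obtain ⟨V, hV, hdisj⟩ := exists_seq_of_forall_finset_exists'
    (fun V : Clopens X => x ∉ V ∧ V ≤ U ∧ ((V : Set X) ∩ iteratedDerivedSet X β).Nonempty)
    Disjoint fun s hs => by
      have hxs : x ∉ s.sup id := by
        rw [← SetLike.mem_coe, Clopens.coe_finset_sup]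
        simpa using fun V hV => (hs V hV).1
      obtain ⟨y, ⟨hyU, hyβ⟩, hyx⟩ := exists_ne_mem_iteratedDerivedSet h hx
        (U \ s.sup id).isOpen ⟨hxU, hxs⟩
      obtain ⟨W, hyW, hW⟩ := exists_clopens_mem_le
        ((U \ s.sup id).isOpen.sdiff isClosed_singleton) ⟨hyU, hyx⟩
      have hWU : W ≤ U \ s.sup id := fun z hz => (hW hz).1
      exact ⟨W, ⟨fun hxW => (hW hxW).2 rfl, hWU.trans sdiff_le, y, hyW, hyβ⟩, fun V hV =>
        (disjoint_sdiff_self_right.mono_right hWU).mono_left (Finset.le_sup (f := id) hV)⟩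
  exact ⟨V, hdisj, fun n => (hV n).2⟩

end TotallyDisconnected

section Countable

variable [CompactSpace X] [T2Space X] [Countable X]

theorem exists_clopens_inter_eq_singleton {S : Set X} (hS : IsClosed S) (hne : S.Nonempty) :
    ∃ (U : Clopens X) (x : X), (U : Set X) ∩ S = {x} := by
  have : Nonempty S := hne.to_subtype
  have : CompactSpace S := isCompact_iff_compactSpace.1 hS.isCompact
  obtain ⟨x, y, hy⟩ := nonempty_interior_of_iUnion_of_closed (X := S)
    (f := fun x : S => {x}) (fun x => isClosed_singleton) (iUnion_of_singleton S)
  obtain rfl : y = x := mem_singleton_iff.1 (interior_subset hy)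
  obtain ⟨O, hO, hyO⟩ := isOpen_induced_iff.1 (isOpen_interior (s := ({y} : Set S)))
  obtain ⟨U, hyU, hUO⟩ := exists_clopens_mem_le hO (show y ∈ Subtype.val ⁻¹' O from hyO ▸ hy)
  refine ⟨U, y, subset_antisymm (fun z hz => ?_) (singleton_subset_iff.2 ⟨hyU, y.2⟩)⟩
  have hzO : (⟨z, hz.2⟩ : S) ∈ Subtype.val ⁻¹' O := hUO hz.1
  rw [hyO] at hzO
  exact congrArg Subtype.val (mem_singleton_iff.1 (interior_subset hzO))

theorem exists_iteratedDerivedSet_eq_empty (X : Type*) [TopologicalSpace X] [CompactSpace X]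
    [T2Space X] [Countable X] : ∃ α, iteratedDerivedSet X α = ∅ := by
  by_contra! hne
  have hrank : ∀ α, ∃ x ∈ iteratedDerivedSet X α, ∀ β > α, x ∉ iteratedDerivedSet X β := by
    intro α
    obtain ⟨U, x, hUx⟩ := exists_clopens_inter_eq_singleton (isClosed_iteratedDerivedSet α) (hne α)
    obtain ⟨hxU, hx⟩ := hUx.ge rfl
    refine ⟨x, hx, fun β hβ hxβ => ?_⟩
    obtain ⟨y, hy, hyx⟩ := exists_ne_mem_iteratedDerivedSet hβ hxβ U.isOpen hxU
    exact hyx (hUx.le hy)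
  choose f hf hf' using hrank
  have hinj : Function.Injective f := fun α β hαβ => by
    by_contra hne
    rcases lt_or_gt_of_ne hne with h | h
    · exact hf' α β h (hαβ ▸ hf β)
    · exact hf' β α h (hαβ ▸ hf α)
  obtain ⟨g, hg⟩ := Countable.exists_injective_nat X
  exact not_injective_of_ordinal.{0} _ (hg.comp hinj)

theorem exists_clopens_encard_inter_iteratedDerivedSet_eq (h : β < α) {x : X}
    (hx : x ∈ iteratedDerivedSet X α) {U : Clopens X} (hxU : x ∈ U) (n : ℕ) :
    ∃ Q ≤ U, x ∉ Q ∧ ((Q : Set X) ∩ iteratedDerivedSet X β).encard = n := by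
  induction n with
  | zero => exact ⟨⊥, bot_le, notMem_empty x, by simp⟩
  | succ n ih =>
    obtain ⟨Q, hQU, hxQ, hcard⟩ := ih
    obtain ⟨y, ⟨hyU, hyβ⟩, hyx⟩ :=
      exists_ne_mem_iteratedDerivedSet h hx (U \ Q).isOpen ⟨hxU, hxQ⟩
    obtain ⟨V, hyV, hV⟩ := exists_clopens_mem_le
      ((U \ Q).isOpen.sdiff isClosed_singleton) ⟨hyU, hyx⟩
    obtain ⟨W, z, hWz⟩ := exists_clopens_inter_eq_singleton
      (V.isClosed.inter (isClosed_iteratedDerivedSet β)) ⟨y, hyV, hyβ⟩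
    have hzV : z ∈ V := (hWz.ge rfl).2.1
    refine ⟨Q ⊔ W ⊓ V, sup_le hQU fun w hw => (hV hw.2).1.1, ?_, ?_⟩
    · rintro (h | h)
      exacts [hxQ h, (hV h.2).2 rfl]
    · have hinsert : ((Q ⊔ W ⊓ V : Clopens X) : Set X) ∩ iteratedDerivedSet X β =
          insert z ((Q : Set X) ∩ iteratedDerivedSet X β) := by
        rw [Clopens.coe_sup, Clopens.coe_inf, union_inter_distrib_right, inter_assoc, hWz,
          union_singleton]
      rw [hinsert, encard_insert_of_notMem fun h => (hV hzV).1.2 h.1, hcard, Nat.cast_succ]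

end Countable

end IteratedDerivedSet

section Classification

section Gluing

variable {X : Type*} [TopologicalSpace X] {ι : Type*} {U : ι → Clopens X}

theorem isOpenEmbedding_sigma_clopens (hU : Pairwise (Function.onFun Disjoint U)) :
    IsOpenEmbedding fun p : Σ i, U i => (p.2 : X) := by
  refine .of_continuous_injective_isOpenMap (continuous_sigma fun _ => continuous_subtype_val) ?_
    (isOpenMap_sigma.2 fun i => (U i).isOpen.isOpenMap_subtype_val)
  rintro ⟨i, x, hx⟩ ⟨j, y, hy⟩ (rfl : x = y)
  obtain rfl : i = j := by
    by_contra h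
    exact disjoint_left.1 (Clopens.coe_disjoint.2 (hU h)) hx hy
  rfl

theorem inter_eq_singleton_of_pairwise_disjoint (hU : Pairwise (Function.onFun Disjoint U))
    {p : ι → X} (hp : ∀ i, p i ∈ U i) {S : Set X}
    (hS : (⋃ i, (U i : Set X)) ∩ S = range p) (i : ι) : (U i : Set X) ∩ S = {p i} := by
  refine subset_antisymm (fun x hx => ?_)
    (singleton_subset_iff.2 ⟨hp i, (hS.ge (mem_range_self i)).2⟩)
  obtain ⟨j, rfl⟩ := hS.le ⟨mem_iUnion_of_mem i hx.1, hx.2⟩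
  by_contra h
  exact disjoint_left.1 (Clopens.coe_disjoint.2 (hU fun hij => h (congrArg p hij.symm)))
    hx.1 (hp j)

/-- Homeomorphic summands yield homeomorphic disjoint sums. -/
def sigmaHomeomorphCongr {A B : ι → Type*} [∀ i, TopologicalSpace (A i)]
    [∀ i, TopologicalSpace (B i)] (e : ∀ i, A i ≃ₜ B i) : (Σ i, A i) ≃ₜ Σ i, B i :=
  (IsHomeomorph.sigmaMap Function.bijective_id fun i => (e i).isHomeomorph).homeomorph _

/-- Pairwise disjoint clopen sets that cover a set split it as their disjoint sum. -/
def sigmaClopensHomeomorph (hU : Pairwise (Function.onFun Disjoint U)) {V : Set X}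
    (hV : ⋃ i, (U i : Set X) = V) : (Σ i, U i) ≃ₜ V := by
  refine (isOpenEmbedding_sigma_clopens hU).isEmbedding.toHomeomorph.trans (.setCongr ?_)
  rw [← hV]
  ext x
  simp

/-- Pairwise disjoint clopen sets that cover all but one point of a compact set display it as the
one-point compactification of their disjoint sum. -/
def onePointSigmaClopensHomeomorph [T2Space X] (hU : Pairwise (Function.onFun Disjoint U))
    {V : Set X} (hV : IsCompact V) {x : X} (hx : x ∈ V) (hUV : ⋃ i, (U i : Set X) = V \ {x}) :
    OnePoint (Σ i, U i) ≃ₜ V :=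
  haveI := isCompact_iff_compactSpace.1 hV
  haveI hmem : ∀ p : Σ i, U i, (p.2 : X) ∈ V \ {x} := fun p =>
    hUV.le (mem_iUnion_of_mem p.1 p.2.2)
  OnePoint.equivOfIsEmbeddingOfRangeEq ⟨x, hx⟩ (fun p => ⟨p.2, (hmem p).1⟩)
    (.of_comp ((isOpenEmbedding_sigma_clopens hU).continuous.subtype_mk _) continuous_subtype_val
      (isOpenEmbedding_sigma_clopens hU).isEmbedding)
    (by
      refine subset_antisymm ?_ fun y hy => ?_
      · rintro _ ⟨p, rfl⟩ h
        exact (hmem p).2 (congrArg Subtype.val h)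
      · obtain ⟨i, hi⟩ := mem_iUnion.1 (hUV.ge ⟨y.2, fun h => hy (Subtype.ext h)⟩)
        exact ⟨⟨i, y, hi⟩, rfl⟩)

end Gluing

/-- Clopen sets meeting the `α`-th derived sets in the same finite nonzero number of points are
homeomorphic: the inductive statement of the Mazurkiewicz–Sierpiński classification. -/
def ClopensClassifiedAt (X Y : Type*) [TopologicalSpace X] [TopologicalSpace Y]
    (α : Ordinal.{0}) : Prop :=
  ∀ (U : Clopens X) (V : Clopens Y), ((U : Set X) ∩ iteratedDerivedSet X α).Nonempty →
    ((U : Set X) ∩ iteratedDerivedSet X α).Finite →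
    ((U : Set X) ∩ iteratedDerivedSet X α).encard =
      ((V : Set Y) ∩ iteratedDerivedSet Y α).encard → Nonempty (U ≃ₜ V)

theorem ClopensClassifiedAt.symm {X Y : Type*} [TopologicalSpace X] [TopologicalSpace Y]
    {α : Ordinal.{0}} (h : ClopensClassifiedAt X Y α) :
    ClopensClassifiedAt Y X α := fun U V hne hfin hcard => by
  refine (h V U ?_ ?_ hcard.symm).map Homeomorph.symm
  · rwa [← encard_ne_zero, ← hcard, encard_ne_zero]
  · rwa [← encard_lt_top_iff, ← hcard, encard_lt_top_iff]

variable {X Y : Type*} [TopologicalSpace X] [CompactSpace X] [T2Space X]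
  [TopologicalSpace Y] [CompactSpace Y] [T2Space Y]

theorem pairwise_disjoint_sdiff_succ {A : Type*} [GeneralizedBooleanAlgebra A] {U : ℕ → A}
    (hU : Antitone U) : Pairwise (Function.onFun Disjoint fun n => U n \ U (n + 1)) :=
  (pairwise_disjoint_on _).2 fun _ _ hmn =>
    disjoint_sdiff_self_left.mono_right (sdiff_le.trans (hU hmn))

theorem iUnion_sdiff_succ {A : Type*} {U : ℕ → Set A} (hU : Antitone U) :
    ⋃ n, U n \ U (n + 1) = U 0 \ ⋂ n, U n := by
  refine subset_antisymm (iUnion_subset fun n z hz => ?_) fun z ⟨hz₀, hz⟩ => ?_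
  · exact ⟨hU n.zero_le hz.1, fun h => hz.2 (mem_iInter.1 h (n + 1))⟩
  · by_contra hcon
    simp only [mem_iUnion, Set.mem_sdiff, not_exists, not_and_not_right] at hcon
    exact hz (mem_iInter.2 fun n => Nat.rec hz₀ hcon n)

theorem nonempty_homeomorph_of_iInter_eq_singleton {U : ℕ → Clopens X} {V : ℕ → Clopens Y}
    (hU : Antitone U) (hV : Antitone V) {x : X} {y : Y} (hUx : ⋂ n, (U n : Set X) = {x})
    (hVy : ⋂ n, (V n : Set Y) = {y})
    (h : ∀ n, Nonempty (↥(U n \ U (n + 1)) ≃ₜ ↥(V n \ V (n + 1)))) :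
    Nonempty (U 0 ≃ₜ V 0) := by
  have hx : x ∈ U 0 := iInter_subset (fun n => (U n : Set X)) 0 (hUx.ge rfl)
  have hy : y ∈ V 0 := iInter_subset (fun n => (V n : Set Y)) 0 (hVy.ge rfl)
  -- Both sets are the one-point compactification of the sum of the successive differences.
  have e := sigmaHomeomorphCongr fun n => (h n).some
  exact ⟨(onePointSigmaClopensHomeomorph (pairwise_disjoint_sdiff_succ hU) (U 0).isClosed.isCompact
    hx (hUx ▸ iUnion_sdiff_succ hU)).symm.trans <|
      e.onePointCongr.trans <|
        onePointSigmaClopensHomeomorph (pairwise_disjoint_sdiff_succ hV) (V 0).isClosed.isCompact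
          hy (hVy ▸ iUnion_sdiff_succ hV)⟩

theorem exists_clopens_partition [TotallyDisconnectedSpace X] {ι : Type*} [Finite ι] [Nonempty ι]
    {p : ι → X} (hp : Function.Injective p) (U : Clopens X) (hpU : ∀ i, p i ∈ U) :
    ∃ P : ι → Clopens X, Pairwise (Function.onFun Disjoint P) ∧ (∀ i, p i ∈ P i) ∧
      ⋃ i, (P i : Set X) = U := by
  obtain ⟨C, hC, hpC, hCU, hUC, hdisj⟩ := exists_clopen_partition_of_clopen_cover
    (Z := fun i => {p i}) (D := fun _ : ι => (U : Set X)) (fun _ => isClosed_singleton)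
    (fun _ => U.isClopen) (fun i => singleton_subset_iff.2 (hpU i))
    (fun i _ j _ hij => disjoint_singleton.2 (hp.ne hij))
  refine ⟨fun i => ⟨C i, hC i⟩, fun i j hij => Clopens.coe_disjoint.1 (hdisj trivial trivial hij),
    fun i => hpC i rfl, subset_antisymm (iUnion_subset hCU) ?_⟩
  rwa [iUnion_const] at hUC

variable [Countable X] [Countable Y] {α : Ordinal.{0}}

theorem exists_clopens_le_of_mem_left (ih : ∀ β < α, ClopensClassifiedAt X Y β)
    {U : Clopens X} {V : Clopens Y} {x : X} {y : Y}
    (hU : (U : Set X) ∩ iteratedDerivedSet X α = {x})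
    (hV : (V : Set Y) ∩ iteratedDerivedSet Y α = {y}) (z : X) :
    ∃ U' ≤ U, ∃ V' ≤ V, x ∈ U' ∧ y ∈ V' ∧ (z ∈ U' → z = x) ∧
      Nonempty (↥(U \ U') ≃ₜ ↥(V \ V')) := by
  obtain ⟨hxU, -⟩ := hU.ge rfl
  obtain ⟨hyV, hy⟩ := hV.ge rfl
  by_cases hz : z ∈ U ∧ z ≠ x
  · obtain ⟨P, hzP, hP⟩ := exists_clopens_mem_le (U.isOpen.sdiff isClosed_singleton) hz
    have hPU : P ≤ U := fun w hw => (hP hw).1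
    have hPα : (P : Set X) ∩ iteratedDerivedSet X α = ∅ := eq_empty_of_forall_notMem fun w hw =>
      (hP hw.1).2 (hU.le ⟨hPU hw.1, hw.2⟩)
    obtain ⟨β, hβ, hne, hfin⟩ := exists_finite_inter_iteratedDerivedSet P.isClosed ⟨z, hzP⟩ hPα
    obtain ⟨Q, hQV, hyQ, hcard⟩ := exists_clopens_encard_inter_iteratedDerivedSet_eq hβ hy hyV
      ((P : Set X) ∩ iteratedDerivedSet X β).ncard
    refine ⟨U \ P, sdiff_le, V \ Q, sdiff_le, ⟨hxU, fun hx => (hP hx).2 rfl⟩, ⟨hyV, hyQ⟩,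
      fun h => absurd hzP h.2, ?_⟩
    rw [sdiff_sdiff_eq_self hPU, sdiff_sdiff_eq_self hQV]
    exact ih β hβ P Q hne hfin (hfin.cast_ncard_eq.symm.trans hcard.symm)
  · refine ⟨U, le_rfl, V, le_rfl, hxU, hyV, fun h => not_not.1 fun hzx => hz ⟨h, hzx⟩, ?_⟩
    rw [_root_.sdiff_self, _root_.sdiff_self]
    have hX : IsEmpty (⊥ : Clopens X) := isEmpty_coe_sort.2 rfl
    have hY : IsEmpty (⊥ : Clopens Y) := isEmpty_coe_sort.2 rfl
    exact ⟨Homeomorph.empty⟩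

theorem exists_clopens_le_of_mem_sum (ih : ∀ β < α, ClopensClassifiedAt X Y β)
    {U : Clopens X} {V : Clopens Y} {x : X} {y : Y}
    (hU : (U : Set X) ∩ iteratedDerivedSet X α = {x})
    (hV : (V : Set Y) ∩ iteratedDerivedSet Y α = {y}) (z : X ⊕ Y) :
    ∃ U' ≤ U, ∃ V' ≤ V, x ∈ U' ∧ y ∈ V' ∧ z.elim (fun a => a ∈ U' → a = x)
      (fun b => b ∈ V' → b = y) ∧ Nonempty (↥(U \ U') ≃ₜ ↥(V \ V')) := by
  rcases z with a | b
  · exact exists_clopens_le_of_mem_left ih hU hV a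
  · obtain ⟨V', hV', U', hU', hy, hx, hb, e⟩ :=
      exists_clopens_le_of_mem_left (fun β hβ => (ih β hβ).symm) hV hU b
    exact ⟨U', hU', V', hV', hx, hy, hb, e.map Homeomorph.symm⟩

/-- The back-and-forth argument: homeomorphic pieces are removed from `U` and `V` along an
enumeration of `X ⊕ Y`, until only `x` and `y` are left. -/
theorem nonempty_homeomorph_of_inter_eq_singleton (ih : ∀ β < α, ClopensClassifiedAt X Y β)
    {U : Clopens X} {V : Clopens Y} {x : X} {y : Y}
    (hU : (U : Set X) ∩ iteratedDerivedSet X α = {x})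
    (hV : (V : Set Y) ∩ iteratedDerivedSet Y α = {y}) : Nonempty (U ≃ₜ V) := by
  let S := {s : Clopens X × Clopens Y //
    (s.1 : Set X) ∩ iteratedDerivedSet X α = {x} ∧ (s.2 : Set Y) ∩ iteratedDerivedSet Y α = {y}}
  have step (z : X ⊕ Y) (s : S) : ∃ s' : S, s'.1 ≤ s.1 ∧
      z.elim (fun a => a ∈ s'.1.1 → a = x) (fun b => b ∈ s'.1.2 → b = y) ∧
      Nonempty (↥(s.1.1 \ s'.1.1) ≃ₜ ↥(s.1.2 \ s'.1.2)) := by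
    obtain ⟨⟨U, V⟩, hU, hV⟩ := s
    obtain ⟨U', hU', V', hV', hx, hy, hz, e⟩ := exists_clopens_le_of_mem_sum ih hU hV z
    refine ⟨⟨(U', V'), ?_, ?_⟩, ⟨hU', hV'⟩, hz, e⟩
    · exact subset_antisymm (hU ▸ inter_subset_inter_left _ hU')
        (singleton_subset_iff.2 ⟨hx, (hU.ge rfl).2⟩)
    · exact subset_antisymm (hV ▸ inter_subset_inter_left _ hV')
        (singleton_subset_iff.2 ⟨hy, (hV.ge rfl).2⟩)
  choose next hnext using step
  have : Nonempty (X ⊕ Y) := ⟨.inl x⟩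
  obtain ⟨enum, henum⟩ := exists_surjective_nat (X ⊕ Y)
  let s : ℕ → S := fun n => n.rec ⟨(U, V), hU, hV⟩ fun n => next (enum n)
  have hs : Antitone fun n => (s n).1 := antitone_nat_of_succ_le fun n => (hnext _ _).1
  refine nonempty_homeomorph_of_iInter_eq_singleton (U := fun n => (s n).1.1)
    (V := fun n => (s n).1.2) (fun m n h => (hs h).1) (fun m n h => (hs h).2) (x := x) (y := y)
    (subset_antisymm (fun a ha => ?_) ?_) (subset_antisymm (fun b hb => ?_) ?_)
    fun n => (hnext _ _).2.2
  · obtain ⟨n, hn⟩ := henum (.inl a)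
    have := (hnext (enum n) (s n)).2.1
    rw [hn] at this
    exact this (hn ▸ mem_iInter.1 ha (n + 1))
  · exact singleton_subset_iff.2 (mem_iInter.2 fun n => ((s n).2.1.ge rfl).1)
  · obtain ⟨n, hn⟩ := henum (.inr b)
    have := (hnext (enum n) (s n)).2.1
    rw [hn] at this
    exact this (hn ▸ mem_iInter.1 hb (n + 1))
  · exact singleton_subset_iff.2 (mem_iInter.2 fun n => ((s n).2.2.ge rfl).1)

theorem clopensClassifiedAt (α : Ordinal.{0}) : ClopensClassifiedAt X Y α := by
  induction α using WellFoundedLT.induction with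
  | ind α ih =>
    intro U V hne hfin hcard
    have : Finite ↥((U : Set X) ∩ iteratedDerivedSet X α) := hfin
    have : Nonempty ↥((U : Set X) ∩ iteratedDerivedSet X α) := hne.to_subtype
    have : Finite ↥((V : Set Y) ∩ iteratedDerivedSet Y α) := by
      rwa [← encard_lt_top_iff, hcard, encard_lt_top_iff] at hfin
    obtain ⟨e⟩ : Nonempty (↥((U : Set X) ∩ iteratedDerivedSet X α) ≃
      ↥((V : Set Y) ∩ iteratedDerivedSet Y α)) := Finite.card_eq.1 (congrArg ENat.toNat hcard)
    obtain ⟨P, hP, hxP, hPU⟩ := exists_clopens_partition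
      (p := fun x : ↥((U : Set X) ∩ iteratedDerivedSet X α) => (x : X)) Subtype.val_injective U
      fun x => x.2.1
    obtain ⟨Q, hQ, hyQ, hQV⟩ := exists_clopens_partition
      (p := fun x => (e x : Y))
      (Subtype.val_injective.comp e.injective) V fun x => (e x).2.1
    have hPQ (x) : Nonempty (P x ≃ₜ Q x) := by
      refine nonempty_homeomorph_of_inter_eq_singleton ih (x := x) (y := e x) ?_ ?_
      · exact inter_eq_singleton_of_pairwise_disjoint hP hxP (by rw [hPU, Subtype.range_coe]) x
      · refine inter_eq_singleton_of_pairwise_disjoint hQ hyQ ?_ x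
        rw [hQV]
        exact ((e.surjective.range_comp Subtype.val).trans Subtype.range_coe).symm
    exact ⟨(sigmaClopensHomeomorph hP hPU).symm.trans <|
      (sigmaHomeomorphCongr fun x => (hPQ x).some).trans (sigmaClopensHomeomorph hQ hQV)⟩

theorem nonempty_homeomorph_of_encard_iteratedDerivedSet_eq
    (h : ∀ α, (iteratedDerivedSet X α).encard = (iteratedDerivedSet Y α).encard) :
    Nonempty (X ≃ₜ Y) := by
  rcases isEmpty_or_nonempty X with hX | hX
  · have : IsEmpty Y := by
      have h₀ := h 0
      rwa [iteratedDerivedSet_zero, iteratedDerivedSet_zero, univ_eq_empty_iff.2 hX, encard_empty,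
        eq_comm, encard_eq_zero, univ_eq_empty_iff] at h₀
    exact ⟨Homeomorph.empty⟩
  obtain ⟨γ, hγ⟩ := exists_iteratedDerivedSet_eq_empty X
  obtain ⟨β, -, hne, hfin⟩ := exists_finite_inter_iteratedDerivedSet isClosed_univ
    univ_nonempty ((univ_inter _).trans hγ)
  exact (clopensClassifiedAt β ⊤ ⊤ hne hfin (by simpa using h β)).map fun e =>
    (Homeomorph.Set.univ X).symm.trans (e.trans (Homeomorph.Set.univ Y))

end Classification

section CZero

theorem containsIsomorphicCopy_of_norm_le {X Y : Type*} [NormedAddCommGroup X] [NormedSpace ℝ X]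
    [NormedAddCommGroup Y] [NormedSpace ℝ Y] (J : Y →L[ℝ] X) {C : ℝ}
    (hJ : ∀ y, ‖y‖ ≤ C * ‖J y‖) : ContainsIsomorphicCopy X Y := by
  have hinj : Function.Injective J := (injective_iff_map_eq_zero J).2 fun y hy =>
    norm_le_zero_iff.1 ((hJ y).trans (by rw [hy, norm_zero, mul_zero]))
  let e := LinearEquiv.ofInjective (J : Y →ₗ[ℝ] X) hinj
  refine ⟨LinearMap.range (J : Y →ₗ[ℝ] X),
    ⟨e.toContinuousLinearEquivOfBounds ‖J‖ C J.le_opNorm fun z => ?_⟩⟩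
  obtain ⟨y, rfl⟩ := e.surjective z
  rw [e.symm_apply_apply]
  exact hJ y

/-- Rosenthal's disjointification lemma. -/
theorem exists_injective_sum_off_diagonal_le {ε : ℝ} (hε : 0 < ε) (a : ℕ → ℕ → ℝ)
    {C : ℝ} (hC : ∀ k (s : Finset ℕ), ∑ j ∈ s, a k j ≤ C) :
    ∃ σ : ℕ → ℕ, Function.Injective σ ∧
      ∀ k (s : Finset ℕ), k ∉ s → ∑ j ∈ s, a (σ k) (σ j) ≤ ε := by
  obtain ⟨N, hN⟩ := exists_nat_ge (C / ε)
  replace hC k s : ∑ j ∈ s, a k j ≤ N * ε := (hC k s).trans ((div_le_iff₀ hε).1 hN)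
  clear hN
  induction N generalizing a with
  | zero => exact ⟨id, Function.injective_id, fun k s _ => (hC k s).trans (by simpa using hε.le)⟩
  | succ N ih =>
    -- Either one of infinitely many disjoint infinite blocks of indices works, or each of them
    -- contains a row with an off-diagonal sum above `ε`, and passing to one such row per block
    -- lowers the bound on the row sums by `ε`.
    by_cases hblock : ∃ p, ∀ k (s : Finset ℕ), k ∉ s →
        ∑ j ∈ s, a (Nat.pair p k) (Nat.pair p j) ≤ ε
    · obtain ⟨p, hp⟩ := hblock
      exact ⟨Nat.pair p, fun _ _ h => (Nat.pair_eq_pair.1 h).2, hp⟩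
    push Not at hblock
    choose K S hKS hS using hblock
    let row : ℕ → ℕ := fun p => Nat.pair p (K p)
    have hrow : Function.Injective row := fun _ _ h => (Nat.pair_eq_pair.1 h).1
    obtain ⟨σ, hσ, hσs⟩ := ih (fun p q => a (row p) (row q)) fun p s => by
      have hdisj : Disjoint (s.image row) ((S p).image (Nat.pair p)) := by
        refine Finset.disjoint_left.2 fun z hz hz' => ?_
        obtain ⟨q, -, rfl⟩ := Finset.mem_image.1 hz
        obtain ⟨j, hj, hjq⟩ := Finset.mem_image.1 hz'
        obtain ⟨rfl, rfl⟩ := Nat.pair_eq_pair.1 hjq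
        exact hKS _ hj
      have hsum := hC (row p) (s.image row ∪ (S p).image (Nat.pair p))
      rw [Finset.sum_union hdisj, Finset.sum_image hrow.injOn,
        Finset.sum_image fun _ _ _ _ h => (Nat.pair_eq_pair.1 h).2] at hsum
      push_cast at hsum
      linarith [hS p]
    exact ⟨row ∘ σ, hrow.comp hσ, hσs⟩

variable {ι E : Type*} [NormedAddCommGroup E] [NormedSpace ℝ E] {v : ι → E}

/-- The series `∑ vⱼ` is weakly unconditionally Cauchy. Of the equivalent descriptions of this
notion, this is the one by uniform bounds on finite partial sums with bounded coefficients. -/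
def IsWeaklyUnconditionallyCauchy (v : ι → E) : Prop :=
  ∃ C, ∀ (s : Finset ι) (a : ι → ℝ) (M : ℝ), 0 ≤ M → (∀ j ∈ s, |a j| ≤ M) →
    ‖∑ j ∈ s, a j • v j‖ ≤ C * M

namespace IsWeaklyUnconditionallyCauchy

theorem comp_injective {κ : Type*} (hv : IsWeaklyUnconditionallyCauchy v) {σ : κ → ι}
    (hσ : Function.Injective σ) : IsWeaklyUnconditionallyCauchy (v ∘ σ) := by
  obtain ⟨C, hC⟩ := hv
  refine ⟨C, fun s a M hM ha => ?_⟩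
  have := hC (s.map ⟨σ, hσ⟩) (Function.extend σ a 0) M hM (by simpa [hσ.extend_apply] using ha)
  simpa [hσ.extend_apply] using this

theorem map {F : Type*} [NormedAddCommGroup F] [NormedSpace ℝ F]
    (hv : IsWeaklyUnconditionallyCauchy v) (R : E →L[ℝ] F) :
    IsWeaklyUnconditionallyCauchy fun i => R (v i) := by
  obtain ⟨C, hC⟩ := hv
  refine ⟨‖R‖ * C, fun s a M hM ha => ?_⟩
  calc ‖∑ i ∈ s, a i • R (v i)‖ = ‖R (∑ i ∈ s, a i • v i)‖ := by simp only [map_sum, map_smul]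
    _ ≤ ‖R‖ * (C * M) := R.le_opNorm_of_le (hC s a M hM ha)
    _ = ‖R‖ * C * M := (mul_assoc _ _ _).symm

theorem exists_sum_abs_dual_le (hv : IsWeaklyUnconditionallyCauchy v) :
    ∃ C, ∀ (φ : StrongDual ℝ E), ‖φ‖ ≤ 1 → ∀ s : Finset ι, ∑ j ∈ s, |φ (v j)| ≤ C := by
  obtain ⟨C, hC⟩ := hv
  refine ⟨C, fun φ hφ s => ?_⟩
  let sgn : ι → ℝ := fun j => SignType.sign (φ (v j))
  have hsgn : ∀ j ∈ s, |sgn j| ≤ 1 := fun j _ => by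
    rcases lt_trichotomy (φ (v j)) 0 with h | h | h <;> simp [sgn, h]
  calc ∑ j ∈ s, |φ (v j)| = φ (∑ j ∈ s, sgn j • v j) := by
        simp only [map_sum, map_smul, smul_eq_mul, sgn, sign_mul_self]
    _ ≤ ‖∑ j ∈ s, sgn j • v j‖ := (le_abs_self _).trans ((φ.le_of_opNorm_le hφ _).trans_eq
        (one_mul _))
    _ ≤ C := by simpa using hC s sgn 1 zero_le_one hsgn

theorem summable_smul [CompleteSpace E] (hv : IsWeaklyUnconditionallyCauchy v) {a : ι → ℝ}
    (ha : Tendsto a cofinite (𝓝 0)) : Summable fun j => a j • v j := by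
  obtain ⟨C, hC⟩ := hv
  refine summable_iff_vanishing_norm.2 fun ε hε => ?_
  have hpos : 0 < ε / (|C| + 1) := by positivity
  have hfin : {j | ¬ |a j| < ε / (|C| + 1)}.Finite :=
    eventually_cofinite.1 (ha.abs.eventually_lt_const (by rwa [abs_zero]))
  refine ⟨hfin.toFinset, fun t ht => ?_⟩
  have hat : ∀ j ∈ t, |a j| ≤ ε / (|C| + 1) := fun j hj => by
    by_contra h
    exact Finset.disjoint_left.1 ht hj (hfin.mem_toFinset.2 fun h' => h h'.le)
  calc ‖∑ j ∈ t, a j • v j‖ ≤ C * (ε / (|C| + 1)) := hC t a _ hpos.le hat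
    _ < (|C| + 1) * (ε / (|C| + 1)) := by
        gcongr
        linarith [le_abs_self C]
    _ = ε := mul_div_cancel₀ ε (by positivity)

end IsWeaklyUnconditionallyCauchy

theorem abs_apply_le_norm_zeroAtInfty (a : C₀(ℕ, ℝ)) (j : ℕ) : |a j| ≤ ‖a‖ :=
  a.toBCF.norm_coe_le_norm j

theorem IsWeaklyUnconditionallyCauchy.exists_hasSum_smul [CompleteSpace E] {v : ℕ → E}
    (hv : IsWeaklyUnconditionallyCauchy v) :
    ∃ J : C₀(ℕ, ℝ) →L[ℝ] E, ∀ a, HasSum (fun j => a j • v j) (J a) := by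
  have hsum (a : C₀(ℕ, ℝ)) : Summable fun j => a j • v j :=
    hv.summable_smul (cocompact_eq_cofinite ℕ ▸ zero_at_infty a)
  obtain ⟨C, hC⟩ := hv
  let J : C₀(ℕ, ℝ) →ₗ[ℝ] E :=
    { toFun := fun a => ∑' j, a j • v j
      map_add' := fun a b => by
        simp only [ZeroAtInftyContinuousMap.add_apply, add_smul]
        exact (hsum a).tsum_add (hsum b)
      map_smul' := fun r a => by
        simp only [ZeroAtInftyContinuousMap.smul_apply, smul_assoc, RingHom.id_apply]
        exact (hsum a).tsum_const_smul r }
  exact ⟨J.mkContinuous C fun a => le_of_tendsto' (hsum a).hasSum.norm fun s =>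
    hC s a _ (norm_nonneg a) fun j _ => abs_apply_le_norm_zeroAtInfty a j,
    fun a => (hsum a).hasSum⟩

theorem abs_mul_abs_dual_le_norm_sum_add [DecidableEq ι] {φ : StrongDual ℝ E} (hφ : ‖φ‖ ≤ 1)
    {a : ι → ℝ} {M ε : ℝ} (ha : ∀ j, |a j| ≤ M) {s : Finset ι} {k : ι} (hk : k ∈ s)
    (hs : ∑ j ∈ s.erase k, |φ (v j)| ≤ ε) :
    |a k| * |φ (v k)| ≤ ‖∑ j ∈ s, a j • v j‖ + M * ε := by
  have hM : 0 ≤ M := (abs_nonneg _).trans (ha k)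
  have hsplit : a k * φ (v k) = φ (∑ j ∈ s, a j • v j) - ∑ j ∈ s.erase k, a j * φ (v j) := by
    rw [← Finset.add_sum_erase _ _ hk, map_add, map_sum, map_smul, smul_eq_mul]
    simp only [map_smul, smul_eq_mul, add_sub_cancel_right]
  have hrest : |∑ j ∈ s.erase k, a j * φ (v j)| ≤ M * ε := by
    calc |∑ j ∈ s.erase k, a j * φ (v j)| ≤ ∑ j ∈ s.erase k, M * |φ (v j)| :=
          (Finset.abs_sum_le_sum_abs _ _).trans <| Finset.sum_le_sum fun j _ => by
            rw [abs_mul]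
            gcongr
            exact ha j
      _ ≤ M * ε := by
          rw [← Finset.mul_sum]
          gcongr
  calc |a k| * |φ (v k)| = |φ (∑ j ∈ s, a j • v j) - ∑ j ∈ s.erase k, a j * φ (v j)| := by
        rw [← abs_mul, hsplit]
    _ ≤ ‖∑ j ∈ s, a j • v j‖ + M * ε := (abs_sub _ _).trans
        (add_le_add ((φ.le_of_opNorm_le hφ _).trans_eq (one_mul _)) hrest)

/-- The Bessaga–Pełczyński theorem. -/
theorem IsWeaklyUnconditionallyCauchy.containsCZero [CompleteSpace E] {v : ℕ → E}
    (hv : IsWeaklyUnconditionallyCauchy v) {η : ℝ} (hη : 0 < η) (hvη : ∀ j, η ≤ ‖v j‖) :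
    ContainsCZero E := by
  choose φ hφ hφv using fun k => exists_dual_vector'' ℝ (v k)
  obtain ⟨C, hC⟩ := hv.exists_sum_abs_dual_le
  obtain ⟨σ, hσ, hσs⟩ := exists_injective_sum_off_diagonal_le (half_pos hη)
    (fun k j => |φ k (v j)|) fun k => hC (φ k) (hφ k)
  obtain ⟨J, hJ⟩ := (hv.comp_injective hσ).exists_hasSum_smul
  have hcoord (a : C₀(ℕ, ℝ)) (k : ℕ) : |a k| * η ≤ ‖J a‖ + ‖a‖ * (η / 2) := by
    refine ge_of_tendsto ((hJ a).norm.add_const _) ?_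
    filter_upwards [eventually_ge_atTop {k}] with s hs
    calc |a k| * η ≤ |a k| * |φ (σ k) (v (σ k))| := by
          gcongr
          rw [hφv]
          exact (hvη _).trans (le_abs_self _)
      _ ≤ _ := abs_mul_abs_dual_le_norm_sum_add (v := v ∘ σ) (hφ _)
          (abs_apply_le_norm_zeroAtInfty a) (hs (Finset.mem_singleton_self k))
          (hσs k _ (Finset.notMem_erase k s))
  refine containsIsomorphicCopy_of_norm_le J (C := 2 / η) fun a => ?_
  have hnorm : ‖a‖ ≤ (‖J a‖ + ‖a‖ * (η / 2)) / η :=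
    (BoundedContinuousFunction.norm_le (f := a.toBCF) (by positivity)).2 fun k =>
      (le_div_iff₀ hη).2 (hcoord a k)
  rw [le_div_iff₀ hη] at hnorm
  rw [div_mul_eq_mul_div, le_div_iff₀ hη]
  linarith

theorem IsWeaklyUnconditionallyCauchy.tendsto_cofinite_zero [CompleteSpace E]
    (hE : ¬ ContainsCZero E) (hv : IsWeaklyUnconditionallyCauchy v) :
    Tendsto v cofinite (𝓝 0) := by
  rw [tendsto_zero_iff_norm_tendsto_zero]
  by_contra h
  obtain ⟨η, hη, hinf⟩ : ∃ η > 0, {j | η ≤ ‖v j‖}.Infinite := by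
    simpa [Metric.tendsto_nhds, frequently_cofinite_iff_infinite] using h
  have := hinf.to_subtype
  let σ := Infinite.natEmbedding {j | η ≤ ‖v j‖}
  exact hE ((hv.comp_injective (Subtype.val_injective.comp σ.injective)).containsCZero hη
    fun n => (σ n).2)

end CZero

section ClopenRestrict

variable {K E : Type*} [TopologicalSpace K] [NormedAddCommGroup E]

/-- The product of a vector-valued function with the indicator function of a clopen set. -/
def clopenRestrict (V : Clopens K) (f : C(K, E)) : C(K, E) :=
  ⟨(V : Set K).indicator f, V.isClopen.continuous_indicator f.continuous⟩

variable {V W : Clopens K} (f : C(K, E)) {x : K}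

theorem clopenRestrict_of_mem (hx : x ∈ V) : clopenRestrict V f x = f x :=
  indicator_of_mem (SetLike.mem_coe.2 hx) f

theorem clopenRestrict_of_notMem (hx : x ∉ V) : clopenRestrict V f x = 0 :=
  indicator_of_notMem (mt SetLike.mem_coe.1 hx) f

theorem norm_sub_two_smul_add_two_smul_clopenRestrict_le [CompactSpace K] [NormedSpace ℝ E]
    (hWV : W ≤ V) :
    ‖f - (2 : ℝ) • clopenRestrict V f + (2 : ℝ) • clopenRestrict W f‖ ≤ ‖f‖ := by
  refine (ContinuousMap.norm_le _ (norm_nonneg f)).2 fun x => ?_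
  simp only [ContinuousMap.add_apply, ContinuousMap.sub_apply, ContinuousMap.smul_apply]
  by_cases hxW : x ∈ W
  · rw [clopenRestrict_of_mem f hxW, clopenRestrict_of_mem f (hWV hxW), sub_add_cancel]
    exact f.norm_coe_le_norm x
  rw [clopenRestrict_of_notMem f hxW, smul_zero, add_zero]
  by_cases hxV : x ∈ V
  · rw [clopenRestrict_of_mem f hxV, two_smul, sub_add_cancel_left, norm_neg]
    exact f.norm_coe_le_norm x
  · rw [clopenRestrict_of_notMem f hxV, smul_zero, sub_zero]
    exact f.norm_coe_le_norm x

theorem isWeaklyUnconditionallyCauchy_clopenRestrict [CompactSpace K] [NormedSpace ℝ E] {ι : Type*}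
    {V : ι → Clopens K} (hV : Pairwise (Function.onFun Disjoint V)) :
    IsWeaklyUnconditionallyCauchy fun i => clopenRestrict (V i) f := by
  refine ⟨‖f‖, fun s a M hM ha => ?_⟩
  refine (ContinuousMap.norm_le _ (by positivity)).2 fun x => ?_
  simp only [ContinuousMap.sum_apply, ContinuousMap.smul_apply]
  by_cases h : ∃ i ∈ s, x ∈ V i
  · obtain ⟨i, hi, hx⟩ := h
    rw [Finset.sum_eq_single_of_mem i hi fun j _ hji => ?_, clopenRestrict_of_mem f hx, norm_smul,
      mul_comm]
    · exact mul_le_mul (f.norm_coe_le_norm x) (ha i hi) (norm_nonneg _) (norm_nonneg f)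
    · have hxj : x ∉ V j := fun hxj => disjoint_left.1 (Clopens.coe_disjoint.2 (hV hji)) hxj hx
      rw [clopenRestrict_of_notMem f hxj, smul_zero]
  · push Not at h
    rw [Finset.sum_eq_zero fun i hi => by rw [clopenRestrict_of_notMem f (h i hi), smul_zero],
      norm_zero]
    positivity

end ClopenRestrict

theorem exists_locallyConstant_apply_eq {K ι : Type*} [TopologicalSpace K] [CompactSpace K]
    [T2Space K] [TotallyDisconnectedSpace K] [Finite ι] [Nonempty ι] {p : ι → K}
    (hp : Function.Injective p) : ∃ r : LocallyConstant K ι, ∀ i, r (p i) = i := by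
  obtain ⟨P, hP, hpP, hcover⟩ := exists_clopens_partition hp ⊤ fun i => mem_univ (p i)
  choose r hr using fun x => mem_iUnion.1 (hcover.ge (mem_univ x))
  have huniq {x : K} {i : ι} (hx : x ∈ P i) : r x = i := by
    by_contra h
    exact disjoint_left.1 (Clopens.coe_disjoint.2 (hP h)) (hr x) hx
  refine ⟨⟨r, IsLocallyConstant.iff_isOpen_fiber.2 fun i => ?_⟩, fun i => huniq (hpP i)⟩
  convert (P i).isOpen
  ext x
  exact ⟨fun h => h ▸ hr x, huniq⟩

section Distortion

variable {K L E F : Type*} [TopologicalSpace K] [CompactSpace K] [T2Space K]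
  [TotallyDisconnectedSpace K] [TopologicalSpace L]
  [NormedAddCommGroup E] [NormedSpace ℝ E] [NormedAddCommGroup F] [NormedSpace ℝ F]
  [CompleteSpace F] {α β : Ordinal.{0}} {x : K}

theorem exists_clopens_norm_lt_of_finite (hF : ¬ ContainsCZero F) (T : C(K, E) →L[ℝ] C(L, F))
    (f : C(K, E)) (h : β < α) (hx : x ∈ iteratedDerivedSet K α) {U : Clopens K} (hxU : x ∈ U)
    {G : Set L} (hG : G.Finite) {δ : ℝ} (hδ : 0 < δ) :
    ∃ V ≤ U, ((V : Set K) ∩ iteratedDerivedSet K β).Nonempty ∧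
      ∀ y ∈ G, ‖T (clopenRestrict V f) y‖ < δ := by
  obtain ⟨V, hdisj, hV⟩ := exists_seq_disjoint_clopens_inter_iteratedDerivedSet h hx hxU
  have hsmall : ∀ᶠ n in cofinite, ∀ y ∈ G, ‖T (clopenRestrict (V n) f) y‖ < δ := by
    refine hG.eventually_all.2 fun y _ => ?_
    have := ((isWeaklyUnconditionallyCauchy_clopenRestrict f hdisj).map
      ((ContinuousMap.evalCLM ℝ y).comp T)).tendsto_cofinite_zero hF
    exact this.norm.eventually_lt_const (by rwa [norm_zero])
  obtain ⟨n, hn⟩ := hsmall.exists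
  exact ⟨V n, (hV n).1, (hV n).2, hn⟩

variable [CompactSpace L] [T1Space L]

theorem exists_clopens_forall_exists_norm_lt (hF : ¬ ContainsCZero F)
    (T : C(K, E) →L[ℝ] C(L, F)) (f : C(K, E)) {δ : ℝ} (hδ : 0 < δ)
    (hx : x ∈ iteratedDerivedSet K α) {U : Clopens K} (hxU : x ∈ U) {G : Set L} (hG : IsClosed G)
    (hGα : G ∩ iteratedDerivedSet L α = ∅) :
    ∃ W ≤ U, (W : Set K).Nonempty ∧ ∀ y ∈ G, ∃ V, W ≤ V ∧ ‖T (clopenRestrict V f) y‖ < δ := by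
  induction α using WellFoundedLT.induction generalizing x U G with
  | ind α ih =>
    rcases G.eq_empty_or_nonempty with rfl | hne
    · exact ⟨U, le_rfl, ⟨x, hxU⟩, fun y hy => absurd hy (notMem_empty y)⟩
    -- A single restriction of `f` has a small image at the finitely many points of top rank in `G`,
    -- and the points of `G` at which its image is not small miss a derived set of smaller order.
    obtain ⟨β, hβ, -, hfin⟩ := exists_finite_inter_iteratedDerivedSet hG hne hGα
    obtain ⟨V, hVU, ⟨z, hzV, hz⟩, hsmall⟩ :=
      exists_clopens_norm_lt_of_finite hF T f hβ hx hxU hfin hδ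
    have hG' : IsClosed (G ∩ {y | δ ≤ ‖T (clopenRestrict V f) y‖}) :=
      hG.inter (isClosed_le continuous_const (map_continuous _).norm)
    obtain ⟨W, hWV, hW, hrest⟩ := ih β hβ hz hzV hG' <| eq_empty_of_forall_notMem
      fun y hy => (hsmall y ⟨hy.1.1, hy.2⟩).not_ge hy.1.2
    refine ⟨W, hWV.trans hVU, hW, fun y hy => ?_⟩
    by_cases hyδ : δ ≤ ‖T (clopenRestrict V f) y‖
    · exact hrest y ⟨hy, hyδ⟩
    · exact ⟨V, hWV, not_le.1 hyδ⟩

theorem exists_clopens_norm_add_two_smul_le (hF : ¬ ContainsCZero F) (T : C(K, E) →L[ℝ] C(L, F))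
    (hx : x ∈ iteratedDerivedSet K α) {U : Clopens K} (hxU : x ∈ U) {f : C(K, E)} {δ : ℝ}
    (hδ : 0 < δ) (hfδ : ∀ y ∈ iteratedDerivedSet L α, ‖T f y‖ < δ) :
    ∃ W ≤ U, (W : Set K).Nonempty ∧
      ‖T (f + (2 : ℝ) • clopenRestrict W f)‖ ≤ ‖T‖ * ‖f‖ + 2 * δ := by
  obtain ⟨W, hWU, hW, hsmall⟩ := exists_clopens_forall_exists_norm_lt hF T f hδ hx hxU
    (G := {y | δ ≤ ‖T f y‖}) (isClosed_le continuous_const (map_continuous _).norm)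
    (eq_empty_of_forall_notMem fun y hy => (hfδ y hy.2).not_ge hy.1)
  refine ⟨W, hWU, hW, (ContinuousMap.norm_le _ (by positivity)).2 fun y => ?_⟩
  obtain ⟨V, hWV, hVδ⟩ : ∃ V, W ≤ V ∧ ‖T (clopenRestrict V f) y‖ < δ := by
    by_cases hy : δ ≤ ‖T f y‖
    · exact hsmall y hy
    · have htop : clopenRestrict ⊤ f = f :=
        ContinuousMap.ext fun z => clopenRestrict_of_mem f (mem_univ z)
      exact ⟨⊤, le_top, by rwa [htop, ← not_le]⟩
  let g := f - (2 : ℝ) • clopenRestrict V f + (2 : ℝ) • clopenRestrict W f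
  have hsplit : T (f + (2 : ℝ) • clopenRestrict W f) y =
      T g y + (2 : ℝ) • T (clopenRestrict V f) y := by
    simp only [g, map_add, map_sub, map_smul, ContinuousMap.add_apply, ContinuousMap.sub_apply,
      ContinuousMap.smul_apply]
    abel
  have hg : ‖T g y‖ ≤ ‖T‖ * ‖f‖ := ((T g).norm_coe_le_norm y).trans
    (T.le_opNorm_of_le (norm_sub_two_smul_add_two_smul_clopenRestrict_le f hWV))
  rw [hsplit]
  refine norm_add_le_of_le hg ?_
  rw [norm_smul, Real.norm_ofNat]
  gcongr

theorem three_mul_norm_apply_le (hF : ¬ ContainsCZero F) (T : C(K, E) →L[ℝ] C(L, F)) {b : ℝ≥0}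
    (hT : AntilipschitzWith b T) (hx : x ∈ iteratedDerivedSet K α) {f : C(K, E)} {δ : ℝ}
    (hδ : 0 ≤ δ) (hfδ : ∀ y ∈ iteratedDerivedSet L α, ‖T f y‖ ≤ δ) :
    3 * ‖f x‖ ≤ b * (‖T‖ * ‖f‖ + 2 * δ) := by
  have happrox (η : ℝ) (hη : 0 < η) : 3 * (‖f x‖ - η) ≤ b * (‖T‖ * ‖f‖ + 2 * (δ + η)) := by
    obtain ⟨U, hxU, hU⟩ := exists_clopens_mem_le (U := {z | ‖f x‖ - η < ‖f z‖})
      (isOpen_lt continuous_const (map_continuous f).norm) (sub_lt_self _ hη)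
    obtain ⟨W, hWU, ⟨w, hw⟩, hW⟩ := exists_clopens_norm_add_two_smul_le hF T hx hxU (f := f)
      (δ := δ + η) (by positivity) fun y hy => (hfδ y hy).trans_lt (lt_add_of_pos_right δ hη)
    calc 3 * (‖f x‖ - η) ≤ 3 * ‖f w‖ := by
          gcongr
          exact le_of_lt (hU (hWU hw))
      _ = ‖(f + (2 : ℝ) • clopenRestrict W f) w‖ := by
          rw [ContinuousMap.add_apply, ContinuousMap.smul_apply, clopenRestrict_of_mem f hw,
            show f w + (2 : ℝ) • f w = (3 : ℝ) • f w by module, norm_smul, Real.norm_ofNat]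
      _ ≤ ‖f + (2 : ℝ) • clopenRestrict W f‖ := ContinuousMap.norm_coe_le_norm _ w
      _ ≤ b * ‖T (f + (2 : ℝ) • clopenRestrict W f)‖ := hT.le_mul_norm (map_zero T) _
      _ ≤ b * (‖T‖ * ‖f‖ + 2 * (δ + η)) := by gcongr
  have hlim : Tendsto (fun η => b * (‖T‖ * ‖f‖ + 2 * (δ + η)) + 3 * η) (𝓝[>] 0)
      (𝓝 (b * (‖T‖ * ‖f‖ + 2 * δ))) :=
    (Continuous.tendsto' (by fun_prop) _ _ (by simp)).mono_left nhdsWithin_le_nhds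
  refine ge_of_tendsto hlim (eventually_mem_nhdsWithin.mono fun η hη => ?_)
  linarith [happrox η hη]

theorem containsIsomorphicCopy_pi_of_iteratedDerivedSet (hF : ¬ ContainsCZero F)
    (T : C(K, E) →L[ℝ] C(L, F)) {b : ℝ≥0} (hT : AntilipschitzWith b T) (hb : b * ‖T‖ < 3)
    {ι κ : Type*} [Fintype ι] [Fintype κ] [Nonempty ι] {p : ι → K} (hp : Function.Injective p)
    (hpα : ∀ i, p i ∈ iteratedDerivedSet K α) {q : κ → L} (hq : iteratedDerivedSet L α ⊆ range q) :
    ContainsIsomorphicCopy (κ → F) (ι → E) := by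
  obtain ⟨r, hr⟩ := exists_locallyConstant_apply_eq hp
  let S : (ι → E) →L[ℝ] C(K, E) := LinearMap.mkContinuous
    { toFun := fun z => (r.map z).toContinuousMap
      map_add' := fun _ _ => rfl
      map_smul' := fun _ _ => rfl } 1 fun z => by
    rw [one_mul]
    exact (ContinuousMap.norm_le _ (norm_nonneg z)).2 fun x => norm_le_pi_norm z (r x)
  have hS : ‖S‖ ≤ 1 := LinearMap.mkContinuous_norm_le _ zero_le_one _
  have hSp (z : ι → E) (i : ι) : S z (p i) = z i := congrArg z (hr i)
  let J : (ι → E) →L[ℝ] (κ → F) := .pi fun k => (ContinuousMap.evalCLM ℝ (q k)).comp (T.comp S)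
  refine containsIsomorphicCopy_of_norm_le J (C := 2 * b / (3 - b * ‖T‖)) fun z => ?_
  have hJ : ∀ y ∈ iteratedDerivedSet L α, ‖T (S z) y‖ ≤ ‖J z‖ := fun y hy => by
    obtain ⟨k, rfl⟩ := hq hy
    exact norm_le_pi_norm (J z) k
  have hcoord (i : ι) : ‖z i‖ ≤ b * (‖T‖ * ‖z‖ + 2 * ‖J z‖) / 3 := by
    rw [le_div_iff₀' three_pos, ← hSp z i]
    refine (three_mul_norm_apply_le hF T hT (hpα i) (norm_nonneg _) hJ).trans ?_
    gcongr
    exact (S.le_of_opNorm_le hS z).trans_eq (one_mul _)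
  have hz := (pi_norm_le_iff_of_nonempty z).2 hcoord
  rw [le_div_iff₀ three_pos] at hz
  rw [div_mul_eq_mul_div, le_div_iff₀ (sub_pos.2 hb)]
  linarith

theorem encard_iteratedDerivedSet_le [Nontrivial E] (hF : ¬ ContainsCZero F)
    (hpow : ∀ m n : ℕ, 1 ≤ m → m < n → ¬ ContainsIsomorphicCopy (Fin m → F) (Fin n → E))
    (T : C(K, E) →L[ℝ] C(L, F)) {b : ℝ≥0} (hT : AntilipschitzWith b T) (hb : b * ‖T‖ < 3) :
    (iteratedDerivedSet K α).encard ≤ (iteratedDerivedSet L α).encard := by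
  by_contra! hlt
  have hfin : (iteratedDerivedSet L α).Finite := encard_lt_top_iff.1 (hlt.trans_le le_top)
  set m := (iteratedDerivedSet L α).ncard with hm
  obtain ⟨t, htα, ht⟩ : ∃ t ⊆ iteratedDerivedSet K α, t.encard = (m + 1 : ℕ) :=
    exists_subset_encard_eq (by
      rw [← hfin.cast_ncard_eq] at hlt
      exact_mod_cast Order.add_one_le_of_lt hlt)
  have htfin : Finite t := finite_of_encard_eq_coe ht
  have : Finite (iteratedDerivedSet L α) := hfin
  let p : Fin (m + 1) ≃ t := (Finite.equivFinOfCardEq (congrArg ENat.toNat ht)).symm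
  let q : Fin m ≃ iteratedDerivedSet L α := (Finite.equivFinOfCardEq hm.symm).symm
  have hcopy : ContainsIsomorphicCopy (Fin m → F) (Fin (m + 1) → E) :=
    containsIsomorphicCopy_pi_of_iteratedDerivedSet hF T hT hb
      (Subtype.val_injective.comp p.injective) (fun i => htα (p i).2) (q := Subtype.val ∘ q)
      (by rw [q.surjective.range_comp, Subtype.range_coe])
  rcases Nat.eq_zero_or_pos m with h₀ | hpos
  · rw [h₀] at hcopy
    obtain ⟨Z, ⟨e⟩⟩ := hcopy
    have : Subsingleton (Fin (0 + 1) → E) := e.injective.subsingleton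
    exact not_subsingleton (Fin (0 + 1) → E) this
  · exact hpow m (m + 1) hpos m.lt_succ_self hcopy

end Distortion

theorem nonempty_homeomorph_of_norm_mul_norm_symm_lt_three {K L E F : Type*}
    [TopologicalSpace K] [CompactSpace K] [T2Space K] [Countable K]
    [TopologicalSpace L] [CompactSpace L] [T2Space L] [Countable L]
    [NormedAddCommGroup E] [NormedSpace ℝ E] [CompleteSpace E] [Nontrivial E]
    [NormedAddCommGroup F] [NormedSpace ℝ F] [CompleteSpace F] [Nontrivial F]
    (hE : ¬ ContainsCZero E) (hF : ¬ ContainsCZero F)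
    (hpow : ∀ m n : ℕ, 1 ≤ m → m < n → ¬ ContainsIsomorphicCopy (Fin m → E) (Fin n → F) ∧
      ¬ ContainsIsomorphicCopy (Fin m → F) (Fin n → E))
    (T : C(K, E) ≃L[ℝ] C(L, F))
    (hT : ‖(T : C(K, E) →L[ℝ] C(L, F))‖ * ‖(T.symm : C(L, F) →L[ℝ] C(K, E))‖ < 3) :
    Nonempty (K ≃ₜ L) :=
  nonempty_homeomorph_of_encard_iteratedDerivedSet_eq fun _ => le_antisymm
    (encard_iteratedDerivedSet_le hF (fun m n hm hmn => (hpow m n hm hmn).2)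
      (T : C(K, E) →L[ℝ] C(L, F)) T.antilipschitz (by rwa [mul_comm]))
    (encard_iteratedDerivedSet_le hE (fun m n hm hmn => (hpow m n hm hmn).1)
      (T.symm : C(L, F) →L[ℝ] C(K, E)) T.symm.antilipschitz hT)

theorem norm_linearIsometryEquiv_conj {X X' Y Y' : Type*}
    [NormedAddCommGroup X] [NormedSpace ℝ X] [NormedAddCommGroup X'] [NormedSpace ℝ X']
    [NormedAddCommGroup Y] [NormedSpace ℝ Y] [NormedAddCommGroup Y'] [NormedSpace ℝ Y']
    (R : X ≃ₗᵢ[ℝ] X') (R' : Y ≃ₗᵢ[ℝ] Y') (T : X →L[ℝ] Y) :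
    ‖(R' : Y →L[ℝ] Y').comp (T.comp (R.symm : X' →L[ℝ] X))‖ = ‖T‖ :=
  R'.toLinearIsometry.norm_toContinuousLinearMap_comp.trans
    (T.opNorm_comp_linearIsometryEquiv R.symm)

theorem nonempty_homeomorph_of_linearIsometryEquiv {K L E F X Y : Type*}
    [TopologicalSpace K] [CompactSpace K] [T2Space K] [Countable K]
    [TopologicalSpace L] [CompactSpace L] [T2Space L] [Countable L]
    [NormedAddCommGroup E] [NormedSpace ℝ E] [CompleteSpace E] [Nontrivial E]
    [NormedAddCommGroup F] [NormedSpace ℝ F] [CompleteSpace F] [Nontrivial F]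
    [NormedAddCommGroup X] [NormedSpace ℝ X] [NormedAddCommGroup Y] [NormedSpace ℝ Y]
    (hE : ¬ ContainsCZero E) (hF : ¬ ContainsCZero F)
    (hpow : ∀ m n : ℕ, 1 ≤ m → m < n → ¬ ContainsIsomorphicCopy (Fin m → E) (Fin n → F) ∧
      ¬ ContainsIsomorphicCopy (Fin m → F) (Fin n → E))
    (R : X ≃ₗᵢ[ℝ] C(K, E)) (R' : Y ≃ₗᵢ[ℝ] C(L, F)) (T : X ≃L[ℝ] Y)
    (hT : ‖(T : X →L[ℝ] Y)‖ * ‖(T.symm : Y →L[ℝ] X)‖ < 3) : Nonempty (K ≃ₜ L) := by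
  refine nonempty_homeomorph_of_norm_mul_norm_symm_lt_three hE hF hpow
    ((R.symm.toContinuousLinearEquiv.trans T).trans R'.toContinuousLinearEquiv) ?_
  rw [← norm_linearIsometryEquiv_conj R R' (T : X →L[ℝ] Y),
    ← norm_linearIsometryEquiv_conj R' R (T.symm : Y →L[ℝ] X)] at hT
  exact hT

section Milman

variable {V : Type*} [AddCommGroup V] [Module ℝ V] [TopologicalSpace V]

theorem isCompact_convexJoin [ContinuousAdd V] [ContinuousSMul ℝ V] {s t : Set V}
    (hs : IsCompact s) (ht : IsCompact t) : IsCompact (convexJoin ℝ s t) := by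
  have himage : convexJoin ℝ s t =
      (fun p : ℝ × V × V => (1 - p.1) • p.2.1 + p.1 • p.2.2) '' (Icc (0 : ℝ) 1 ×ˢ s ×ˢ t) := by
    ext z
    simp only [mem_convexJoin, segment_eq_image, mem_image, mem_prod, Prod.exists]
    constructor
    · rintro ⟨a, ha, b, hb, θ, hθ, rfl⟩
      exact ⟨θ, a, b, ⟨hθ, ha, hb⟩, rfl⟩
    · rintro ⟨θ, a, b, ⟨hθ, ha, hb⟩, rfl⟩
      exact ⟨a, ha, b, hb, θ, hθ, rfl⟩
  rw [himage]
  exact (isCompact_Icc.prod (hs.prod ht)).image (by fun_prop)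

variable [IsTopologicalAddGroup V] [T2Space V]

theorem exists_mem_nhds_notMem_closure_convexHull [LocallyConvexSpace ℝ V] {x y : V} (h : x ≠ y) :
    ∃ s ∈ 𝓝 x, y ∉ closure (convexHull ℝ s) := by
  obtain ⟨t, ⟨htx, htc⟩, ht⟩ := (closed_nhds_basis x).mem_iff.1 (isOpen_ne.mem_nhds h)
  obtain ⟨s, ⟨hsx, hs⟩, hst⟩ := (LocallyConvexSpace.convex_basis (𝕜 := ℝ) x).mem_iff.1 htx
  refine ⟨s, hsx, fun hy => ht (closure_minimal hst htc ?_) rfl⟩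
  rwa [← hs.convexHull_eq]

variable [ContinuousSMul ℝ V]

theorem closure_convexHull_union_subset_convexJoin {s t : Set V} (hs : s.Nonempty) (ht : t.Nonempty)
    (hsc : IsCompact (closure (convexHull ℝ s))) (htc : IsCompact (closure (convexHull ℝ t))) :
    closure (convexHull ℝ (s ∪ t)) ⊆
      convexJoin ℝ (closure (convexHull ℝ s)) (closure (convexHull ℝ t)) := by
  have hs' : s ⊆ closure (convexHull ℝ s) := (subset_convexHull ℝ s).trans subset_closure
  have ht' : t ⊆ closure (convexHull ℝ t) := (subset_convexHull ℝ t).trans subset_closure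
  refine closure_minimal (convexHull_min (union_subset ?_ ?_) ?_)
    (isCompact_convexJoin hsc htc).isClosed
  · exact hs'.trans (subset_convexJoin_left (ht.mono ht'))
  · exact ht'.trans (subset_convexJoin_right (hs.mono hs'))
  · exact (convex_convexHull ℝ s).closure.convexJoin (convex_convexHull ℝ t).closure

theorem mem_closure_convexHull_or_of_mem_extremePoints_union {s t : Set V}
    (hc : IsCompact (closure (convexHull ℝ (s ∪ t)))) {x : V}
    (hx : x ∈ (closure (convexHull ℝ (s ∪ t))).extremePoints ℝ) :
    x ∈ closure (convexHull ℝ s) ∨ x ∈ closure (convexHull ℝ t) := by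
  rcases s.eq_empty_or_nonempty with rfl | hs
  · exact .inr (by simpa only [empty_union] using hx.1)
  rcases t.eq_empty_or_nonempty with rfl | ht
  · exact .inl (by simpa only [union_empty] using hx.1)
  have hsub_s : closure (convexHull ℝ s) ⊆ closure (convexHull ℝ (s ∪ t)) := by
    gcongr; exact subset_union_left
  have hsub_t : closure (convexHull ℝ t) ⊆ closure (convexHull ℝ (s ∪ t)) := by
    gcongr; exact subset_union_right
  obtain ⟨a, ha, b, hb, hab⟩ := mem_convexJoin.1 (closure_convexHull_union_subset_convexJoin hs ht
    (hc.of_isClosed_subset isClosed_closure hsub_s)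
    (hc.of_isClosed_subset isClosed_closure hsub_t) hx.1)
  rcases (mem_extremePoints_iff_forall_segment.1 hx).2 a (hsub_s ha) b (hsub_t hb) hab with
    rfl | rfl
  · exact .inl ha
  · exact .inr hb

/-- **Milman's theorem**. -/
theorem extremePoints_closure_convexHull_subset [LocallyConvexSpace ℝ V] {D : Set V}
    (hD : IsCompact D) (hc : IsCompact (closure (convexHull ℝ D))) :
    (closure (convexHull ℝ D)).extremePoints ℝ ⊆ D := by
  intro x hx
  by_contra hxD
  suffices h : x ∉ closure (convexHull ℝ (D ∩ D)) by
    rw [inter_self] at h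
    exact h hx.1
  refine hD.induction_on (p := fun s => x ∉ closure (convexHull ℝ (s ∩ D))) ?_ ?_ ?_ ?_
  · simp only [empty_inter, convexHull_empty, closure_empty, notMem_empty, not_false_eq_true]
  · exact fun s t hst => mt fun h =>
      closure_mono (convexHull_mono (inter_subset_inter_left D hst)) h
  · intro s t hs ht h
    have hsub : closure (convexHull ℝ (s ∩ D ∪ t ∩ D)) ⊆ closure (convexHull ℝ D) :=
      closure_mono (convexHull_mono (union_subset inter_subset_right inter_subset_right))
    rw [union_inter_distrib_right] at h
    exact (mem_closure_convexHull_or_of_mem_extremePoints_union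
      (hc.of_isClosed_subset isClosed_closure hsub)
      (inter_extremePoints_subset_extremePoints_of_subset hsub ⟨h, hx⟩)).elim hs ht
  · intro d hd
    obtain ⟨s, hs, hxs⟩ := exists_mem_nhds_notMem_closure_convexHull (ne_of_mem_of_not_mem hd hxD)
    exact ⟨s, mem_nhdsWithin_of_mem_nhds hs,
      mt (fun h => closure_mono (convexHull_mono inter_subset_left) h) hxs⟩

theorem exists_mem_extremePoints_forall_apply_le [LocallyConvexSpace ℝ V] {s : Set V}
    (hs : IsCompact s) (hne : s.Nonempty) (l : StrongDual ℝ V) :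
    ∃ x ∈ s.extremePoints ℝ, ∀ y ∈ s, l y ≤ l x := by
  obtain ⟨z, hz, hmax⟩ := hs.exists_isMaxOn hne l.continuous.continuousOn
  have hexp : IsExposed ℝ s (l.toExposed s) := ContinuousLinearMap.toExposed.isExposed
  obtain ⟨x, hx⟩ := (hexp.isCompact hs).extremePoints_nonempty ⟨z, hz, hmax⟩
  exact ⟨x, hexp.isExtreme.extremePoints_subset_extremePoints hx, hx.1.2⟩

end Milman

section ChoquetBoundary

variable {K X : Type*} [TopologicalSpace K] [CompactSpace K] [NormedAddCommGroup X]
  [NormedSpace ℝ X]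

instance : LocallyConvexSpace ℝ (WeakDual ℝ X) :=
  WeakBilin.locallyConvexSpace (B := topDualPairing ℝ X)

variable (X) in
/-- The closed unit ball of the dual of `X`, as a subset of the weak-* dual. -/
def weakDualUnitBall : Set (WeakDual ℝ X) :=
  WeakDual.toStrongDual ⁻¹' Metric.closedBall 0 1

theorem mem_weakDualUnitBall {φ : WeakDual ℝ X} : φ ∈ weakDualUnitBall X ↔ ∀ f, |φ f| ≤ ‖f‖ := by
  rw [weakDualUnitBall, mem_preimage, mem_closedBall_zero_iff,
    ContinuousLinearMap.opNorm_le_iff zero_le_one]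
  simp only [one_mul, Real.norm_eq_abs, WeakDual.toStrongDual_apply]

theorem isCompact_weakDualUnitBall : IsCompact (weakDualUnitBall X) :=
  WeakDual.isCompact_closedBall _ _

theorem convex_weakDualUnitBall : Convex ℝ (weakDualUnitBall X) :=
  (convex_closedBall (0 : StrongDual ℝ X) 1).linear_preimage WeakDual.toStrongDual.toLinearMap

theorem neg_mem_weakDualUnitBall {φ : WeakDual ℝ X} :
    -φ ∈ weakDualUnitBall X ↔ φ ∈ weakDualUnitBall X := by
  simp only [weakDualUnitBall, mem_preimage, map_neg, mem_closedBall_zero_iff, norm_neg]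

theorem neg_mem_extremePoints_weakDualUnitBall {φ : WeakDual ℝ X} :
    -φ ∈ (weakDualUnitBall X).extremePoints ℝ ↔ φ ∈ (weakDualUnitBall X).extremePoints ℝ := by
  have hneg : LinearEquiv.neg ℝ '' weakDualUnitBall X = weakDualUnitBall X := by
    ext ψ
    simp [neg_mem_weakDualUnitBall]
  nth_rw 1 [← hneg]
  rw [← image_extremePoints]
  simp

/-- The evaluation functional at `x`, as an element of the weak-* dual of a space `X` of scalar
functions on `K`; the functions are given by an isometric embedding `ι`. -/
def weakEval (ι : X →ₗᵢ[ℝ] C(K, ℝ)) (x : K) : WeakDual ℝ X :=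
  StrongDual.toWeakDual ((ContinuousMap.evalCLM ℝ x : C(K, ℝ) →L[ℝ] ℝ).comp
    ι.toContinuousLinearMap)

variable (ι : X →ₗᵢ[ℝ] C(K, ℝ))

theorem weakEval_apply (x : K) (f : X) : weakEval ι x f = ι f x := rfl

theorem continuous_weakEval : Continuous (weakEval ι) :=
  WeakDual.continuous_of_continuous_eval fun f => (ι f).continuous

theorem weakEval_mem_weakDualUnitBall (x : K) : weakEval ι x ∈ weakDualUnitBall X :=
  mem_weakDualUnitBall.2 fun f => ((ι f).norm_coe_le_norm x).trans (ι.norm_map f).le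

theorem closure_convexHull_range_weakEval [Nonempty K] :
    closure (convexHull ℝ (range (weakEval ι) ∪ range (-weakEval ι))) = weakDualUnitBall X := by
  refine (closure_minimal (convexHull_min ?_ convex_weakDualUnitBall)
    isCompact_weakDualUnitBall.isClosed).antisymm fun φ hφ => ?_
  · rintro φ (⟨x, rfl⟩ | ⟨x, rfl⟩)
    · exact weakEval_mem_weakDualUnitBall ι x
    · exact neg_mem_weakDualUnitBall.2 (weakEval_mem_weakDualUnitBall ι x)
  by_contra hcon
  obtain ⟨l, u, hlu, hu⟩ := geometric_hahn_banach_closed_point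
    (convex_convexHull ℝ _).closure isClosed_closure hcon
  obtain ⟨g, rfl⟩ := LinearMap.dualEmbedding_surjective (topDualPairing ℝ X) l
  have hsub := (subset_convexHull ℝ (range (weakEval ι) ∪ range (-weakEval ι))).trans
    subset_closure
  have hgu (x : K) : |ι g x| < u := by
    have hpos : ι g x < u := hlu _ (hsub (.inl ⟨x, rfl⟩))
    have hneg : -ι g x < u := hlu _ (hsub (.inr ⟨x, rfl⟩))
    exact abs_lt.2 ⟨neg_lt.1 hneg, hpos⟩
  have hnorm : ‖ι g‖ ≤ u := (ContinuousMap.norm_le_of_nonempty _).2 fun x => (hgu x).le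
  have hφg : φ g ≤ ‖ι g‖ := by
    rw [ι.norm_map]
    exact (le_abs_self _).trans (mem_weakDualUnitBall.1 hφ g)
  exact (hφg.trans hnorm).not_gt hu

theorem extremePoints_weakDualUnitBall_subset [Nonempty K] :
    (weakDualUnitBall X).extremePoints ℝ ⊆ range (weakEval ι) ∪ range (-weakEval ι) := by
  have hcompact : IsCompact (range (weakEval ι) ∪ range (-weakEval ι)) :=
    (isCompact_range (continuous_weakEval ι)).union (isCompact_range (continuous_weakEval ι).neg)
  rw [← closure_convexHull_range_weakEval ι]
  refine extremePoints_closure_convexHull_subset hcompact ?_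
  rw [closure_convexHull_range_weakEval]
  exact isCompact_weakDualUnitBall

theorem exists_weakEval_mem_extremePoints_abs_eq_norm [Nonempty K] (g : X) :
    ∃ x, weakEval ι x ∈ (weakDualUnitBall X).extremePoints ℝ ∧ |ι g x| = ‖g‖ := by
  have hne : (weakDualUnitBall X).Nonempty :=
    ⟨weakEval ι (Classical.arbitrary K), weakEval_mem_weakDualUnitBall ι _⟩
  let l : StrongDual ℝ (WeakDual ℝ X) := WeakBilin.eval (topDualPairing ℝ X) g
  obtain ⟨φ, hφ, hmax⟩ :=
    exists_mem_extremePoints_forall_apply_le isCompact_weakDualUnitBall hne l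
  have hφg : ‖g‖ ≤ φ g := by
    obtain ⟨ψ, hψ, hψg⟩ := exists_dual_vector'' ℝ g
    exact hψg.ge.trans (hmax (StrongDual.toWeakDual ψ) (mem_closedBall_zero_iff.2 hψ))
  rcases extremePoints_weakDualUnitBall_subset ι hφ with ⟨x, rfl⟩ | ⟨x, rfl⟩
  · refine ⟨x, hφ, le_antisymm ?_ (hφg.trans (le_abs_self _))⟩
    exact mem_weakDualUnitBall.1 (weakEval_mem_weakDualUnitBall ι x) g
  · refine ⟨x, neg_mem_extremePoints_weakDualUnitBall.1 hφ,
      le_antisymm ?_ (hφg.trans (neg_le_abs _))⟩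
    exact mem_weakDualUnitBall.1 (weakEval_mem_weakDualUnitBall ι x) g

theorem evalFunctional_mem_extremePoints {A : Submodule ℝ C(K, ℝ)} {x : K}
    (h : weakEval A.subtypeₗᵢ x ∈ (weakDualUnitBall A).extremePoints ℝ) :
    evalFunctional A x ∈ (dualUnitBall A).extremePoints ℝ := by
  have hbound (φ : StrongDual ℝ A) (hφ : φ ∈ dualUnitBall A) (f : A) :
      ‖φ.toLinearMap f‖ ≤ 1 * ‖f‖ := (hφ f).trans_eq (one_mul _).symm
  rw [mem_extremePoints_iff_left] at h ⊢
  -- The topologies on `A` underlying `StrongDual ℝ A` and `WeakDual ℝ A` agree only up to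
  -- unfolding, so functionals are transferred by `LinearMap.mkContinuous`.
  refine ⟨fun f => (f : C(K, ℝ)).norm_coe_le_norm x, fun φ hφ ψ hψ hseg => ?_⟩
  have heq := h.2 (StrongDual.toWeakDual (φ.toLinearMap.mkContinuous 1 (hbound φ hφ)))
    (mem_weakDualUnitBall.2 hφ)
    (StrongDual.toWeakDual (ψ.toLinearMap.mkContinuous 1 (hbound ψ hψ)))
    (mem_weakDualUnitBall.2 hψ) (by
      obtain ⟨a, b, ha, hb, hab, h⟩ := hseg
      exact ⟨a, b, ha, hb, hab, DFunLike.ext _ _ fun f => DFunLike.congr_fun h f⟩)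
  exact ContinuousLinearMap.ext fun f => DFunLike.congr_fun heq f

variable {E : Type*} [NormedAddCommGroup E] [NormedSpace ℝ E] (H : Submodule ℝ C(K, E))

theorem exists_mem_choquetBoundary_abs_eq_norm [Nonempty K] {g : C(K, ℝ)}
    (hg : g ∈ scalarSpace H) : ∃ x ∈ choquetBoundary H, |g x| = ‖g‖ := by
  obtain ⟨x, hx, hxg⟩ :=
    exists_weakEval_mem_extremePoints_abs_eq_norm (X := scalarSpace H) (scalarSpace H).subtypeₗᵢ
      ⟨g, hg⟩
  exact ⟨x, evalFunctional_mem_extremePoints hx, hxg⟩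

theorem norm_le_of_forall_mem_choquetBoundary {h : C(K, E)} (hh : h ∈ H) {M : ℝ} (hM : 0 ≤ M)
    (hle : ∀ x ∈ choquetBoundary H, ‖h x‖ ≤ M) : ‖h‖ ≤ M := by
  refine (ContinuousMap.norm_le _ hM).2 fun y => ?_
  have : Nonempty K := ⟨y⟩
  obtain ⟨φ, hφ, hφy⟩ := exists_dual_vector'' ℝ (h y)
  have hmem : dualComp φ h ∈ scalarSpace H :=
    Submodule.le_topologicalClosure _ (Submodule.subset_span ⟨φ, h, hh, rfl⟩)
  obtain ⟨x, hx, hxn⟩ := exists_mem_choquetBoundary_abs_eq_norm H hmem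
  calc ‖h y‖ = φ (h y) := hφy.symm
    _ ≤ ‖dualComp φ h‖ := (le_abs_self _).trans ((dualComp φ h).norm_coe_le_norm y)
    _ = ‖φ (h x)‖ := hxn.symm
    _ ≤ ‖h x‖ := (φ.le_of_opNorm_le hφ _).trans_eq (one_mul _)
    _ ≤ M := hle x hx

end ChoquetBoundary

section PeakFunctions

variable {L E : Type*} [TopologicalSpace L] [NormedAddCommGroup E] [NormedSpace ℝ E]

/-- The space `M` contains every continuous function that vanishes off the clopen set `U`. -/
def ContainsSupportedIn (M : Submodule ℝ C(L, E)) (U : Clopens L) : Prop :=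
  ∀ f : C(L, E), clopenRestrict U f ∈ M

/-- The variant of `IsWeakPeakPoint` in which the peak functions are small off `U` everywhere, not
only on the Choquet boundary. -/
def IsApproxPeakPoint (M : Submodule ℝ C(L, E)) (x : L) : Prop :=
  ∀ U ∈ 𝓝 x, ∀ ε : ℝ, 0 < ε → ε < 1 → ∃ h : C(L, ℝ), (∀ e : E, tensorVec h e ∈ M) ∧
    (∀ y, 0 ≤ h y ∧ h y ≤ 1) ∧ 1 - ε < h x ∧ ∀ y ∉ U, h y < ε

variable {M : Submodule ℝ C(L, E)} {U V : Clopens L}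

theorem ContainsSupportedIn.mono (hU : ContainsSupportedIn M U) (hVU : V ≤ U) :
    ContainsSupportedIn M V := fun f => by
  convert hU (clopenRestrict V f) using 1
  ext x
  by_cases hx : x ∈ U
  · rw [clopenRestrict_of_mem _ hx]
  · rw [clopenRestrict_of_notMem _ hx, clopenRestrict_of_notMem _ (mt (@hVU x) hx)]

theorem ContainsSupportedIn.sup (hU : ContainsSupportedIn M U) (hV : ContainsSupportedIn M V) :
    ContainsSupportedIn M (U ⊔ V) := fun f => by
  convert M.add_mem (hU f) (hV (f - clopenRestrict U f)) using 1
  ext x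
  rw [ContinuousMap.add_apply]
  by_cases hxV : x ∈ V
  · rw [clopenRestrict_of_mem _ (Or.inr hxV : x ∈ U ⊔ V), clopenRestrict_of_mem _ hxV,
      ContinuousMap.sub_apply, add_sub_cancel]
  rw [clopenRestrict_of_notMem _ hxV, add_zero]
  by_cases hxU : x ∈ U
  · rw [clopenRestrict_of_mem _ (Or.inl hxU : x ∈ U ⊔ V), clopenRestrict_of_mem _ hxU]
  · rw [clopenRestrict_of_notMem _ (not_or.2 ⟨hxU, hxV⟩ : x ∉ U ⊔ V),
      clopenRestrict_of_notMem _ hxU]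

theorem containsSupportedIn_of_forall_mem [CompactSpace L]
    (h : ∀ x ∈ V, ∃ U, ContainsSupportedIn M U ∧ x ∈ U) : ContainsSupportedIn M V := by
  obtain ⟨U, hU, hVU⟩ : ∃ U, ContainsSupportedIn M U ∧ (V : Set L) ⊆ U := by
    refine V.isClopen.isClosed.isCompact.induction_on ?_ ?_ ?_ fun x hx => ?_
    · refine ⟨⊥, fun f => ?_, Subset.rfl⟩
      convert M.zero_mem
      exact ContinuousMap.ext fun x => clopenRestrict_of_notMem f (notMem_empty x)
    · exact fun s t hst ⟨U, hU, htU⟩ => ⟨U, hU, hst.trans htU⟩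
    · exact fun s t ⟨U, hU, hsU⟩ ⟨W, hW, htW⟩ =>
        ⟨U ⊔ W, hU.sup hW, union_subset_union hsU htW⟩
    · obtain ⟨U, hU, hxU⟩ := h x hx
      exact ⟨U, mem_nhdsWithin_of_mem_nhds (U.isClopen.isOpen.mem_nhds hxU), U, hU, Subset.rfl⟩
  exact hU.mono hVU

theorem norm_sub_smul_le {e v : E} {t δ : ℝ} (hv : ‖v - e‖ ≤ δ) (htδ : 1 - δ ≤ t) (ht : t ≤ 1) :
    ‖v - t • e‖ ≤ δ + δ * ‖e‖ := by
  calc ‖v - t • e‖ = ‖(v - e) + (1 - t) • e‖ := by rw [sub_smul, one_smul, sub_add_sub_cancel]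
    _ ≤ ‖v - e‖ + ‖(1 - t) • e‖ := norm_add_le _ _
    _ ≤ δ + δ * ‖e‖ := by
      rw [norm_smul, Real.norm_of_nonneg (sub_nonneg.2 ht)]
      gcongr
      exact sub_le_comm.1 htδ

variable [CompactSpace L]

theorem norm_clopenRestrict_sub_tensorVec_add_le {f : C(L, E)} {h : C(L, ℝ)} {e : E} {δ : ℝ}
    (hδ : 0 ≤ δ) (h01 : ∀ y, 0 ≤ h y ∧ h y ≤ 1) (hV : ∀ y ∈ V, 1 - δ ≤ h y ∧ ‖f y - e‖ ≤ δ)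
    (hU : ∀ y ∉ U, h y ≤ δ) :
    ‖clopenRestrict U f - (tensorVec h e + clopenRestrict (U \ V) (f - tensorVec h e))‖ ≤
      δ + δ * ‖e‖ := by
  refine (ContinuousMap.norm_le _ (by positivity)).2 fun y => ?_
  have htensor : tensorVec h e y = h y • e := rfl
  rw [ContinuousMap.sub_apply, ContinuousMap.add_apply, htensor]
  by_cases hyU : y ∈ U
  · rw [clopenRestrict_of_mem _ hyU]
    by_cases hyV : y ∈ V
    · rw [clopenRestrict_of_notMem _ fun hy : y ∈ U \ V => hy.2 hyV, add_zero]
      exact norm_sub_smul_le (hV y hyV).2 (hV y hyV).1 (h01 y).2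
    · rw [clopenRestrict_of_mem _ (⟨hyU, hyV⟩ : y ∈ U \ V), ContinuousMap.sub_apply, htensor,
        add_sub_cancel, _root_.sub_self, norm_zero]
      positivity
  · rw [clopenRestrict_of_notMem _ hyU, clopenRestrict_of_notMem _ fun hy : y ∈ U \ V => hyU hy.1,
      add_zero, zero_sub, norm_neg, norm_smul, Real.norm_of_nonneg (h01 y).1]
    calc h y * ‖e‖ ≤ δ * ‖e‖ := by gcongr; exact hU y hyU
      _ ≤ δ + δ * ‖e‖ := le_add_of_nonneg_left hδ

variable [T2Space L] [TotallyDisconnectedSpace L]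

theorem IsApproxPeakPoint.containsSupportedIn (hM : IsClosed (M : Set C(L, E))) {x : L}
    (hpeak : IsApproxPeakPoint M x) (hxU : x ∈ U)
    (h : ∀ y ∈ U, y ≠ x → ∃ V, ContainsSupportedIn M V ∧ y ∈ V) : ContainsSupportedIn M U := by
  refine fun f => hM.closure_subset (Metric.mem_closure_iff.2 fun ε hε => ?_)
  obtain ⟨δ, hδ, hδmin⟩ := exists_between (lt_min one_pos
    (show 0 < ε / (1 + ‖f x‖) by positivity))
  obtain ⟨hδ1, hδε⟩ := lt_min_iff.1 hδmin
  rw [lt_div_iff₀ (by positivity), mul_add, mul_one] at hδε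
  obtain ⟨p, hpM, hp01, hpx, hpU⟩ := hpeak U (U.isOpen.mem_nhds hxU) δ hδ hδ1
  have hopen : IsOpen {y | 1 - δ < p y ∧ ‖f y - f x‖ < δ} :=
    (isOpen_lt continuous_const (map_continuous p)).inter
      (isOpen_lt ((map_continuous f).sub continuous_const).norm continuous_const)
  obtain ⟨V, hxV, hV⟩ := exists_clopens_mem_le hopen
    ⟨hpx, by rwa [_root_.sub_self, norm_zero]⟩
  have hUV : ContainsSupportedIn M (U \ V) := containsSupportedIn_of_forall_mem fun y hy =>
    h y hy.1 fun hyx => hy.2 (hyx ▸ hxV)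
  refine ⟨_, M.add_mem (hpM (f x)) (hUV (f - tensorVec p (f x))), ?_⟩
  rw [dist_eq_norm]
  exact (norm_clopenRestrict_sub_tensorVec_add_le hδ.le hp01
    (fun y hy => ⟨(hV hy).1.le, (hV hy).2.le⟩) fun y hy => (hpU y hy).le).trans_lt hδε

theorem eq_top_of_forall_isApproxPeakPoint [Countable L] (hM : IsClosed (M : Set C(L, E)))
    (hpeak : ∀ x, IsApproxPeakPoint M x) : M = ⊤ := by
  suffices hall : ∀ x, ∃ U, ContainsSupportedIn M U ∧ x ∈ U by
    refine eq_top_iff.2 fun f _ => ?_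
    have hf := containsSupportedIn_of_forall_mem (V := ⊤) (fun x _ => hall x) f
    rwa [show clopenRestrict ⊤ f = f from
      ContinuousMap.ext fun x => clopenRestrict_of_mem f (mem_univ x)] at hf
  by_contra! hex
  have hclosed : IsClosed {x | ∀ U, ContainsSupportedIn M U → x ∉ U} := by
    simp only [ofPred_forall]
    exact isClosed_iInter fun U => isClosed_iInter fun _ => U.isOpen.isClosed_compl
  obtain ⟨U, x, hUx⟩ := exists_clopens_inter_eq_singleton hclosed hex
  obtain ⟨hxU, hx⟩ := hUx.ge (mem_singleton x)
  refine hx U ((hpeak x).containsSupportedIn hM hxU fun y hyU hyx => ?_) hxU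
  by_contra! hy
  exact hyx (mem_singleton_iff.1 (hUx.le ⟨hyU, hy⟩))

end PeakFunctions

section Restriction

variable {K E : Type*} [TopologicalSpace K] [CompactSpace K] [NormedAddCommGroup E]
  [NormedSpace ℝ E]

/-- Restriction of the functions in `H` to its Choquet boundary, as a linear isometry. -/
def restrictChoquet (H : Submodule ℝ C(K, E)) [CompactSpace (choquetBoundary H)] :
    H →ₗᵢ[ℝ] C(choquetBoundary H, E) where
  toFun h := (h : C(K, E)).restrict (choquetBoundary H)
  map_add' _ _ := rfl
  map_smul' _ _ := rfl
  norm_map' h := by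
    refine le_antisymm ?_ ?_
    · exact (ContinuousMap.norm_le _ (norm_nonneg _)).2 fun x =>
        (h : C(K, E)).norm_coe_le_norm (x : K)
    · exact norm_le_of_forall_mem_choquetBoundary H h.2 (norm_nonneg _) fun x hx =>
        ((h : C(K, E)).restrict (choquetBoundary H)).norm_coe_le_norm ⟨x, hx⟩

theorem IsWeakPeakPoint.isApproxPeakPoint_range_restrictChoquet {H : Submodule ℝ C(K, E)}
    [CompactSpace (choquetBoundary H)] {x : choquetBoundary H} (hx : IsWeakPeakPoint H x) :
    IsApproxPeakPoint (LinearMap.range (restrictChoquet H).toLinearMap) x := by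
  intro U hU ε hε hε1
  obtain ⟨U', hU', hU'U⟩ := (mem_nhds_subtype _ _ _).1 hU
  obtain ⟨h, -, hten, h01, hhx, hoff⟩ := hx U' hU' ε hε hε1
  exact ⟨h.restrict (choquetBoundary H), fun e => ⟨⟨tensorVec h e, hten e⟩, rfl⟩,
    fun y => h01 y, hhx, fun y hy => hoff y ⟨y.2, fun hyU' => hy (hU'U hyU')⟩⟩

theorem nonempty_linearIsometryEquiv_choquetBoundary [T2Space K] [CompleteSpace E]
    {H : Submodule ℝ C(K, E)} (hH : IsClosed (H : Set C(K, E)))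
    [CompactSpace (choquetBoundary H)] [Countable (choquetBoundary H)]
    (hpeak : ∀ x ∈ choquetBoundary H, IsWeakPeakPoint H x) :
    Nonempty (H ≃ₗᵢ[ℝ] C(choquetBoundary H, E)) := by
  have : CompleteSpace H := hH.completeSpace_coe
  have hclosed : IsClosed (range (restrictChoquet H)) :=
    (restrictChoquet H).isometry.isClosedEmbedding.isClosed_range
  have htop : LinearMap.range (restrictChoquet H).toLinearMap = ⊤ :=
    eq_top_of_forall_isApproxPeakPoint hclosed fun x =>
      (hpeak x x.2).isApproxPeakPoint_range_restrictChoquet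
  exact ⟨.ofSurjective (restrictChoquet H) (LinearMap.range_eq_top.1 htop)⟩

end Restriction

end

theorem theorem1p2
    {K₁ K₂ E₁ E₂ : Type*}
    [TopologicalSpace K₁] [CompactSpace K₁] [T2Space K₁]
    [TopologicalSpace K₂] [CompactSpace K₂] [T2Space K₂]
    [NormedAddCommGroup E₁] [NormedSpace ℝ E₁] [CompleteSpace E₁] [Nontrivial E₁]
    [NormedAddCommGroup E₂] [NormedSpace ℝ E₂] [CompleteSpace E₂] [Nontrivial E₂]
    (hE₁ : ¬ ContainsCZero E₁) (hE₂ : ¬ ContainsCZero E₂)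
    (H₁ : Submodule ℝ C(K₁, E₁)) (H₂ : Submodule ℝ C(K₂, E₂))
    (hH₁ : IsClosed (H₁ : Set C(K₁, E₁))) (hH₂ : IsClosed (H₂ : Set C(K₂, E₂)))
    (hclosed₁ : IsClosed (choquetBoundary H₁)) (hclosed₂ : IsClosed (choquetBoundary H₂))
    (hcount₁ : (choquetBoundary H₁).Countable) (hcount₂ : (choquetBoundary H₂).Countable)
    (hpeak₁ : ∀ x ∈ choquetBoundary H₁, IsWeakPeakPoint H₁ x)
    (hpeak₂ : ∀ x ∈ choquetBoundary H₂, IsWeakPeakPoint H₂ x)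
    (hpow₁ : ∀ m n : ℕ, 1 ≤ m → m < n → ¬ ContainsIsomorphicCopy (Fin m → E₁) (Fin n → E₂))
    (hpow₂ : ∀ m n : ℕ, 1 ≤ m → m < n → ¬ ContainsIsomorphicCopy (Fin m → E₂) (Fin n → E₁))
    (hT : ∃ T : H₁ ≃L[ℝ] H₂,
      ‖(T : H₁ →L[ℝ] H₂)‖ * ‖(T.symm : H₂ →L[ℝ] H₁)‖ < 3) :
    Nonempty (choquetBoundary H₁ ≃ₜ choquetBoundary H₂) := by
  obtain ⟨T, hT⟩ := hT
  have : Countable (choquetBoundary H₁) := hcount₁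
  have : Countable (choquetBoundary H₂) := hcount₂
  have : CompactSpace (choquetBoundary H₁) := isCompact_iff_compactSpace.1 hclosed₁.isCompact
  have : CompactSpace (choquetBoundary H₂) := isCompact_iff_compactSpace.1 hclosed₂.isCompact
  obtain ⟨R₁⟩ := nonempty_linearIsometryEquiv_choquetBoundary hH₁ hpeak₁
  obtain ⟨R₂⟩ := nonempty_linearIsometryEquiv_choquetBoundary hH₂ hpeak₂
  exact nonempty_homeomorph_of_linearIsometryEquiv hE₁ hE₂
    (fun m n hm hmn => ⟨hpow₁ m n hm hmn, hpow₂ m n hm hmn⟩) R₁ R₂ T hT
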